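/- Let $f$ be the random completely multiplicative function: the values $f(p)$, $p$ prime, are independent random variables with $\mathbb{P}(f(p)=1)=\mathbb{P}(f(p)=-1)=\tfrac12$, and $f$ is extended to all positive integers by complete multiplicativity, i.e. $f(1)=1$ and $f(mn)=f(m)f(n)$ for all $m,n\ge 1$. For real $x$ put $$S_x=\sum_{1\le n\le x}\frac{f(n)}{\sqrt n}.$$ Then with probability $1$ the sum $S_x$ changes sign infinitely many times as $x\to\infty$; that is, almost surely, for every $X$ there are real numbers $y>x\ge X$ such that $S_x$ and $S_y$ are nonzero and of opposite signs. -/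

import Mathlib

open MeasureTheory ProbabilityTheory

/-- `f` is a random completely multiplicative function on the probability space `(Ω, μ)`:
the values `f p` at the primes are independent random signs, each equal to `1` or `-1` with
probability `1/2`, and `f` is completely multiplicative on the positive integers.
The value `f 0` plays no role and is left unconstrained. -/
structure IsRandomCompletelyMultiplicative {Ω : Type*} [MeasurableSpace Ω] (μ : Measure Ω)
    (f : ℕ → Ω → ℤ) : Prop where
  map_one : ∀ ω, f 1 ω = 1
  map_mul : ∀ ω, ∀ m n : ℕ, 0 < m → 0 < n → f (m * n) ω = f m ω * f n ω
  measurable_prime : ∀ p : Nat.Primes, Measurable (f p)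
  prob_one : ∀ p : Nat.Primes, μ {ω | f p ω = 1} = 1 / 2
  prob_neg_one : ∀ p : Nat.Primes, μ {ω | f p ω = -1} = 1 / 2
  indep : iIndepFun (fun p : Nat.Primes => f p) μ

/-- The partial sum `S_x = ∑_{1 ≤ n ≤ x} a n / √n`, for real `x`. -/
noncomputable def partialSum (a : ℕ → ℤ) (x : ℝ) : ℝ :=
  ∑ n ∈ Finset.Icc 1 ⌊x⌋₊, (a n : ℝ) / Real.sqrt n

/-- `S x` changes sign infinitely many times as `x → ∞`: beyond every `X` there are two points
at which `S` takes values of (strictly) opposite signs. -/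
def ChangesSignInfinitelyOften (S : ℝ → ℝ) : Prop :=
  ∀ X : ℝ, ∃ x y : ℝ, X ≤ x ∧ x < y ∧ S x * S y < 0

/-! Write F(s) for ∑ f(n) n^(-1/2-s). Summation by parts gives F(s)/s = ∑ S_n K_s(n), where the
kernel K_s(n) = ∫_n^(n+1) x^(-s-1) dx lies in [0, 1] and decreases in s. If S_n were eventually
nonnegative, F(s)/s would increase, up to O(1), as s decreases; if S_n were eventually nonpositive,
F(s)/s would be bounded above. Both fail if, for some fixed l < 1 and infinitely many scales s → 0,
F(s)/s is large and at least twice F(ls)/(ls) (`changesSignInfinitelyOften_of_frequently`).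

Such scales come from the Euler product. The logarithm of F(s)/F(ls) is roughly Gaussian with
variance log(1/l), and its drift is bounded below in terms of that variance. So for small l the
quotient exceeds 16/l with probability bounded below; this is obtained from the second, third and
sixth moments (`exists_block_probability`). Moreover 1/F(s) has mean one for every finite Euler
product, so F(s) is rarely smaller than a large multiple of s.

At each scale only a finite block of primes matters: the smaller primes change the quotient by a
factor at least 1/2 once s is small, and the larger ones are negligible in mean square, since E
f(m)f(n) = 0 unless mn is a square. Disjoint blocks give independent events of probability at least
c, so the second Borel–Cantelli lemma yields infinitely many successes, while the first one discards
the approximation errors. Only finite sums and finite products are compared, so convergence of the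
random series F(s) is never needed. -/

open Filter Topology

/-! ### Prime sums near the pole of zeta -/

/-- The weight `p ^ (-(1/2 + s))`. -/
noncomputable def primeWeight (p : Nat.Primes) (s : ℝ) : ℝ := (p : ℝ) ^ (-(1 / 2 + s))

lemma primeWeight_pos (p : Nat.Primes) (s : ℝ) : 0 < primeWeight p s :=
  Real.rpow_pos_of_pos (by exact_mod_cast p.2.pos) _

lemma primeWeight_mul (p : Nat.Primes) (s t : ℝ) :
    primeWeight p s * primeWeight p t = (p : ℝ) ^ (-(1 + (s + t))) := by
  rw [primeWeight, primeWeight, ← Real.rpow_add (by exact_mod_cast p.2.pos)]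
  congr 1; ring

lemma primeWeight_le {p : Nat.Primes} {s t : ℝ} (h : s ≤ t) : primeWeight p t ≤ primeWeight p s :=
  Real.rpow_le_rpow_of_exponent_le (by exact_mod_cast p.2.one_le) (by linarith)

lemma primeWeight_lt_one (p : Nat.Primes) {s : ℝ} (hs : 0 ≤ s) : primeWeight p s < 1 :=
  Real.rpow_lt_one_of_one_lt_of_neg (by exact_mod_cast p.2.one_lt) (by linarith)

lemma continuous_primeWeight (p : Nat.Primes) : Continuous (primeWeight p) := by
  unfold primeWeight
  exact Continuous.rpow continuous_const (by fun_prop)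
    fun _ => Or.inl (by exact_mod_cast p.2.ne_zero)

lemma summable_primes_rpow {x : ℝ} (hx : 0 < x) :
    Summable fun p : Nat.Primes => (p : ℝ) ^ (-(1 + x)) :=
  Nat.Primes.summable_rpow.2 (by linarith)

/-- The logarithm of the Euler product of the zeta function at `1 + x`. -/
lemma tsum_neg_log_one_sub_primes {x : ℝ} (hx : 0 < x) :
    Summable (fun p : Nat.Primes => -Real.log (1 - (p : ℝ) ^ (-(1 + x)))) ∧
    Real.exp (∑' p : Nat.Primes, -Real.log (1 - (p : ℝ) ^ (-(1 + x))))
      = ∑' n : ℕ, 1 / (n : ℝ) ^ (1 + x) := by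
  have hlt (p : Nat.Primes) : (p : ℝ) ^ (-(1 + x)) < 1 :=
    Real.rpow_lt_one_of_one_lt_of_neg (by exact_mod_cast p.2.one_lt) (by linarith)
  have hsum : Summable (fun p : Nat.Primes => -Real.log (1 - (p : ℝ) ^ (-(1 + x)))) := by
    have := (Real.summable_log_one_add_of_summable (summable_primes_rpow hx).neg).neg
    simpa [sub_eq_add_neg] using this
  refine ⟨hsum, ?_⟩
  let g : ℕ →*₀ ℝ :=
    { toFun := fun n => (n : ℝ) ^ (-(1 + x))
      map_zero' := by
        simp only [Nat.cast_zero]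
        exact Real.zero_rpow (by linarith)
      map_one' := by simp
      map_mul' := fun m n => by
        push_cast
        exact Real.mul_rpow (Nat.cast_nonneg _) (Nat.cast_nonneg _) }
  have hg : Summable fun n => ‖g n‖ := by
    have : Summable fun n : ℕ => (n : ℝ) ^ (-(1 + x)) := Real.summable_nat_rpow.2 (by linarith)
    exact this.norm
  have h1 := EulerProduct.eulerProduct_completely_multiplicative_tprod hg
  have h2 : ∀ p : Nat.Primes, -Real.log (1 - (p : ℝ) ^ (-(1 + x)))
      = Real.log ((1 - (p : ℝ) ^ (-(1 + x)))⁻¹) := fun p => (Real.log_inv _).symm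
  simp only [h2] at hsum ⊢
  rw [Real.rexp_tsum_eq_tprod (fun p => inv_pos.2 (sub_pos.2 (hlt p))) hsum]
  refine h1.trans (tsum_congr fun n => ?_)
  change (n : ℝ) ^ (-(1 + x)) = _
  rw [Real.rpow_neg (Nat.cast_nonneg _), one_div]

lemma neg_log_one_sub_bounds {t : ℝ} (h0 : 0 ≤ t) (h1 : t ≤ 1 / 2) :
    t ≤ -Real.log (1 - t) ∧ -Real.log (1 - t) ≤ t + 2 * t ^ 2 := by
  constructor
  · have := Real.log_le_sub_one_of_pos (show 0 < 1 - t by linarith)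
    linarith
  · have h := Real.one_sub_inv_le_log_of_pos (show 0 < 1 - t by linarith)
    have : (1 - t)⁻¹ ≤ 1 + t + 2 * t ^ 2 := by
      rw [inv_le_comm₀ (by linarith) (by positivity), inv_le_iff_one_le_mul₀ (by positivity)]
      nlinarith [mul_nonneg h0 h0, mul_nonneg (mul_nonneg h0 h0) (sub_nonneg.2 h1)]
    linarith

/-- The prime zeta function at `1 + x` is `log (1 / x) + O(1)` as `x → 0+`. -/
lemma exists_abs_tsum_primes_rpow_add_log_le :
    ∃ C, ∀ᶠ x in 𝓝[>] (0 : ℝ), |∑' p : Nat.Primes, (p : ℝ) ^ (-(1 + x)) + Real.log x| ≤ C := by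
  have h2 : Summable fun p : Nat.Primes => (p : ℝ) ^ (-(1 + (1 : ℝ))) :=
    summable_primes_rpow one_pos
  -- The sum over p^(-2) pays for the higher prime powers in log ζ(1 + x); the 1 pays for log (x ζ(1
  -- + x)), which tends to 0.
  refine ⟨2 * ∑' p : Nat.Primes, (p : ℝ) ^ (-(1 + (1 : ℝ))) + 1, ?_⟩
  have hlim : Tendsto (fun x : ℝ => x * ∑' n : ℕ, 1 / (n : ℝ) ^ (1 + x)) (𝓝[>] 0) (𝓝 1) := by
    have hshift : Tendsto (fun x : ℝ => 1 + x) (𝓝[>] 0) (𝓝[>] 1) := by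
      refine tendsto_nhdsWithin_iff.2 ⟨?_, ?_⟩
      · have : Tendsto (fun x : ℝ => 1 + x) (𝓝 0) (𝓝 (1 + 0)) := by
          exact (continuous_const.add continuous_id).tendsto 0
        rw [add_zero] at this
        exact this.mono_left nhdsWithin_le_nhds
      · filter_upwards [self_mem_nhdsWithin] with x hx
        simpa using hx
    refine (tendsto_sub_mul_tsum_nat_rpow.comp hshift).congr fun x => ?_
    simp
  have hlog : Tendsto (fun x : ℝ => Real.log (x * ∑' n : ℕ, 1 / (n : ℝ) ^ (1 + x)))
      (𝓝[>] 0) (𝓝 0) := by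
    have := ((Real.continuousAt_log one_ne_zero).tendsto).comp hlim
    rwa [Real.log_one] at this
  have hev := (Metric.tendsto_nhds.1 hlog) 1 one_pos
  filter_upwards [hev, self_mem_nhdsWithin] with x hx hx0
  have hx0 : 0 < x := hx0
  obtain ⟨hsum, hexp⟩ := tsum_neg_log_one_sub_primes hx0
  rw [← hexp, Real.log_mul hx0.ne' (Real.exp_pos _).ne', Real.log_exp, Real.dist_eq, sub_zero,
    abs_lt] at hx
  have hb (p : Nat.Primes) : 0 ≤ (p : ℝ) ^ (-(1 + x)) ∧ (p : ℝ) ^ (-(1 + x)) ≤ 1 / 2 ∧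
      ((p : ℝ) ^ (-(1 + x))) ^ 2 ≤ (p : ℝ) ^ (-(1 + (1 : ℝ))) := by
    have hp0 : (0 : ℝ) < p := by exact_mod_cast p.2.pos
    have hp1 : (1 : ℝ) ≤ p := by exact_mod_cast p.2.one_le
    have hp2 : (2 : ℝ) ≤ p := by exact_mod_cast p.2.two_le
    refine ⟨by positivity, ?_, ?_⟩
    · calc (p : ℝ) ^ (-(1 + x)) ≤ (p : ℝ) ^ (-1 : ℝ) :=
            Real.rpow_le_rpow_of_exponent_le hp1 (by linarith)
        _ ≤ 1 / 2 := by
            rw [Real.rpow_neg_one, one_div]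
            exact inv_anti₀ (by norm_num) hp2
    · rw [← Real.rpow_natCast, ← Real.rpow_mul hp0.le]
      exact Real.rpow_le_rpow_of_exponent_le hp1 (by push_cast; linarith)
  have hP := summable_primes_rpow hx0
  have hlow := Summable.tsum_le_tsum (fun p => (neg_log_one_sub_bounds (hb p).1 (hb p).2.1).1)
    hP hsum
  have hup : ∑' p : Nat.Primes, -Real.log (1 - (p : ℝ) ^ (-(1 + x))) ≤
      ∑' p : Nat.Primes, ((p : ℝ) ^ (-(1 + x)) + 2 * (p : ℝ) ^ (-(1 + (1 : ℝ)))) := by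
    refine Summable.tsum_le_tsum (fun p => ?_) hsum (hP.add (h2.mul_left 2))
    have := (neg_log_one_sub_bounds (hb p).1 (hb p).2.1).2
    linarith [(hb p).2.2]
  rw [hP.tsum_add (h2.mul_left 2), tsum_mul_left] at hup
  have h2pos : 0 ≤ ∑' p : Nat.Primes, (p : ℝ) ^ (-(1 + (1 : ℝ))) :=
    tsum_nonneg fun p => by positivity
  rw [abs_le]
  constructor <;> linarith

lemma summable_primeWeight_mul {s t : ℝ} (h : 0 < s + t) :
    Summable fun p : Nat.Primes => primeWeight p s * primeWeight p t := by
  simpa only [primeWeight_mul] using summable_primes_rpow h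

lemma summable_primeWeight_sub_sq {s t : ℝ} (hs : 0 < s) (ht : 0 < t) :
    Summable fun p : Nat.Primes => (primeWeight p t - primeWeight p s) ^ 2 := by
  have := ((summable_primeWeight_mul (add_pos ht ht)).sub
    ((summable_primeWeight_mul (add_pos hs ht)).mul_left 2)).add
    (summable_primeWeight_mul (add_pos hs hs))
  exact this.congr fun p => by ring

lemma summable_primeWeight_mul_sub {s t : ℝ} (hs : 0 < s) (ht : 0 < t) :
    Summable fun p : Nat.Primes => primeWeight p s * (primeWeight p t - primeWeight p s) := by
  have := (summable_primeWeight_mul (add_pos hs ht)).sub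
    (summable_primeWeight_mul (add_pos hs hs))
  exact this.congr fun p => by ring

/-- The variance `∑ (c_p(ls) - c_p(s))²` is `log (1 / l) + O(1)`, and the drift
`∑ c_p(s) (c_p(ls) - c_p(s))` is `O(1)`. -/
lemma exists_primeWeight_sums_bound :
    ∃ C, ∀ l : ℝ, 0 < l → l < 1 → ∀ᶠ s in 𝓝[>] (0 : ℝ),
      |∑' p : Nat.Primes, (primeWeight p (l * s) - primeWeight p s) ^ 2 + Real.log l| ≤ C ∧
      ∑' p : Nat.Primes, primeWeight p s * (primeWeight p (l * s) - primeWeight p s) ≤ C := by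
  obtain ⟨C, hC⟩ := exists_abs_tsum_primes_rpow_add_log_le
  -- With P the prime zeta function at 1 + x, the variance is P(2ls) - 2P((1+l)s) + P(2s) and the
  -- drift P((1+l)s) - P(2s). The terms log s cancel, and log (1 + l) lies in [0, log 2], so the
  -- constant does not depend on l; `l` can thus be chosen after it.
  refine ⟨4 * C + 2 * Real.log 2, fun l hl0 hl1 => ?_⟩
  have hscale (k : ℝ) (hk : 0 < k) : Tendsto (fun s : ℝ => k * s) (𝓝[>] 0) (𝓝[>] 0) := by
    refine tendsto_nhdsWithin_iff.2 ⟨?_, ?_⟩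
    · have : Tendsto (fun s : ℝ => k * s) (𝓝 0) (𝓝 (k * 0)) :=
        (continuous_const.mul continuous_id).tendsto 0
      rw [mul_zero] at this
      exact this.mono_left nhdsWithin_le_nhds
    · filter_upwards [self_mem_nhdsWithin] with s hs
      exact mul_pos hk hs
  filter_upwards [(hscale 2 two_pos).eventually hC, (hscale (1 + l) (by linarith)).eventually hC,
    (hscale (2 * l) (by linarith)).eventually hC, self_mem_nhdsWithin] with s h1 h2 h3 hs
  have hs : 0 < s := hs
  have hls : 0 < l * s := mul_pos hl0 hs
  have e1 : ∑' p : Nat.Primes, primeWeight p s * primeWeight p s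
      = ∑' p : Nat.Primes, (p : ℝ) ^ (-(1 + 2 * s)) :=
    tsum_congr fun p => by rw [primeWeight_mul]; congr 1; ring
  have e2 : ∑' p : Nat.Primes, primeWeight p s * primeWeight p (l * s)
      = ∑' p : Nat.Primes, (p : ℝ) ^ (-(1 + (1 + l) * s)) :=
    tsum_congr fun p => by rw [primeWeight_mul]; congr 1; ring
  have e3 : ∑' p : Nat.Primes, primeWeight p (l * s) * primeWeight p (l * s)
      = ∑' p : Nat.Primes, (p : ℝ) ^ (-(1 + 2 * l * s)) :=
    tsum_congr fun p => by rw [primeWeight_mul]; congr 1; ring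
  have s1 := summable_primeWeight_mul (add_pos hs hs)
  have s2 := summable_primeWeight_mul (add_pos hs hls)
  have s3 := summable_primeWeight_mul (add_pos hls hls)
  have q : ∑' p : Nat.Primes, (primeWeight p (l * s) - primeWeight p s) ^ 2
      = (∑' p : Nat.Primes, primeWeight p (l * s) * primeWeight p (l * s))
        - 2 * (∑' p : Nat.Primes, primeWeight p s * primeWeight p (l * s))
        + ∑' p : Nat.Primes, primeWeight p s * primeWeight p s := by
    rw [← tsum_mul_left, ← s3.tsum_sub (s2.mul_left 2), ← (s3.sub (s2.mul_left 2)).tsum_add s1]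
    exact tsum_congr fun p => by ring
  have d : ∑' p : Nat.Primes, primeWeight p s * (primeWeight p (l * s) - primeWeight p s)
      = (∑' p : Nat.Primes, primeWeight p s * primeWeight p (l * s))
        - ∑' p : Nat.Primes, primeWeight p s * primeWeight p s := by
    rw [← s2.tsum_sub s1]
    exact tsum_congr fun p => by ring
  rw [q, d, e1, e2, e3]
  rw [Real.log_mul two_ne_zero hs.ne', abs_le] at h1
  rw [Real.log_mul (by linarith) hs.ne', abs_le] at h2
  rw [mul_assoc 2 l s, Real.log_mul two_ne_zero hls.ne', Real.log_mul hl0.ne' hs.ne', abs_le,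
    ← mul_assoc 2 l s] at h3
  have hl2 : Real.log (1 + l) ≤ Real.log 2 := Real.log_le_log (by linarith) (by linarith)
  have hl3 : 0 ≤ Real.log (1 + l) := Real.log_nonneg (by linarith)
  refine ⟨abs_le.2 ⟨?_, ?_⟩, ?_⟩ <;> linarith

/-! ### Independence and orthogonality of the values of f -/

namespace IsRandomCompletelyMultiplicative

variable {Ω : Type*} [MeasurableSpace Ω] {μ : Measure Ω} [IsProbabilityMeasure μ]
  {f : ℕ → Ω → ℤ}

lemma ae_eq_one_or (hf : IsRandomCompletelyMultiplicative μ f) :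
    ∀ᵐ ω ∂μ, ∀ p : Nat.Primes, f p ω = 1 ∨ f p ω = -1 := by
  rw [ae_all_iff]
  intro p
  have h1 : MeasurableSet {ω | f p ω = 1} := hf.measurable_prime p (measurableSet_singleton 1)
  have h2 : MeasurableSet {ω | f p ω = -1} :=
    hf.measurable_prime p (measurableSet_singleton (-1))
  have hd : Disjoint {ω | f p ω = 1} {ω | f p ω = -1} := by
    rw [Set.disjoint_left]
    intro ω h h'
    simp only [Set.mem_ofPred_eq] at h h'
    omega
  have hu : μ ({ω | f p ω = 1} ∪ {ω | f p ω = -1}) = 1 := by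
    rw [measure_union hd h2, hf.prob_one, hf.prob_neg_one, ENNReal.add_halves]
  exact (mem_ae_iff_prob_eq_one (h1.union h2)).2 hu

lemma integral_comp_prime (hf : IsRandomCompletelyMultiplicative μ f) (p : Nat.Primes)
    (φ : ℤ → ℝ) : ∫ ω, φ (f p ω) ∂μ = (φ 1 + φ (-1)) / 2 := by
  have h1 : MeasurableSet {ω | f p ω = 1} := hf.measurable_prime p (measurableSet_singleton 1)
  have h2 : MeasurableSet {ω | f p ω = -1} :=
    hf.measurable_prime p (measurableSet_singleton (-1))
  have hae : (fun ω => φ (f p ω)) =ᵐ[μ] fun ω =>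
      ({ω | f p ω = 1}.indicator (fun _ => φ 1) ω)
        + ({ω | f p ω = -1}.indicator (fun _ => φ (-1)) ω) := by
    filter_upwards [hf.ae_eq_one_or] with ω hω
    rcases hω p with h | h <;> simp [h, Set.indicator]
  rw [integral_congr_ae hae, integral_add ((integrable_const _).indicator h1)
    ((integrable_const _).indicator h2), integral_indicator_const _ h1,
    integral_indicator_const _ h2, measureReal_def, measureReal_def, hf.prob_one,
    hf.prob_neg_one]
  simp
  ring

/-- Expectations of products over distinct primes factor. -/
lemma integral_prod_primes (hf : IsRandomCompletelyMultiplicative μ f) (B : Finset Nat.Primes)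
    (φ : Nat.Primes → ℤ → ℝ) :
    ∫ ω, ∏ p ∈ B, φ p (f p ω) ∂μ = ∏ p ∈ B, (φ p 1 + φ p (-1)) / 2 := by
  have hB : iIndepFun (fun p : B => f (p : Nat.Primes)) μ :=
    hf.indep.precomp Subtype.val_injective
  have := hB.integral_fun_prod_comp (fun p => (hf.measurable_prime p).aemeasurable)
    (f := fun p : B => φ p) (fun p => (measurable_of_countable _).aestronglyMeasurable)
  simp only [hf.integral_comp_prime] at this
  rw [Finset.prod_coe_sort B (fun p : Nat.Primes => (φ p 1 + φ p (-1)) / 2)] at this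
  rw [← this]
  refine integral_congr_ae (Eventually.of_forall fun ω => ?_)
  exact (Finset.prod_coe_sort B (fun p : Nat.Primes => φ p (f p ω))).symm

omit [IsProbabilityMeasure μ] in
lemma measurable_of_pos (hf : IsRandomCompletelyMultiplicative μ f) {n : ℕ} (hn : 0 < n) :
    Measurable (f n) := by
  induction n using Nat.recOnMul with
  | zero => omega
  | one =>
    have : f 1 = fun _ => 1 := funext hf.map_one
    rw [this]; exact measurable_const
  | prime p hp => exact hf.measurable_prime ⟨p, hp⟩
  | mul a b iha ihb =>
    have ha : 0 < a := Nat.pos_of_mul_pos_right hn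
    have hb : 0 < b := Nat.pos_of_mul_pos_left hn
    have : f (a * b) = fun ω => f a ω * f b ω := funext fun ω => hf.map_mul ω a b ha hb
    rw [this]
    exact (iha ha).mul (ihb hb)

/-- A realization of `f`, twisted by `n ^ (-s)`, as a homomorphism vanishing at `0`. -/
noncomputable def toHom (hf : IsRandomCompletelyMultiplicative μ f) (ω : Ω) (s : ℝ) :
    ℕ →*₀ ℝ where
  toFun n := if n = 0 then 0 else (f n ω : ℝ) * (n : ℝ) ^ (-s)
  map_zero' := by simp
  map_one' := by simp [hf.map_one]
  map_mul' m n := by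
    rcases Nat.eq_zero_or_pos m with rfl | hm
    · simp
    rcases Nat.eq_zero_or_pos n with rfl | hn
    · simp
    rw [if_neg (Nat.mul_pos hm hn).ne', if_neg hm.ne', if_neg hn.ne', hf.map_mul ω m n hm hn]
    push_cast
    rw [Real.mul_rpow (Nat.cast_nonneg _) (Nat.cast_nonneg _)]
    ring

omit [IsProbabilityMeasure μ] in
lemma toHom_apply (hf : IsRandomCompletelyMultiplicative μ f) (ω : Ω) (s : ℝ) {n : ℕ}
    (hn : 0 < n) : hf.toHom ω s n = (f n ω : ℝ) * (n : ℝ) ^ (-s) := if_neg hn.ne'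

omit [IsProbabilityMeasure μ] in
lemma cast_eq_prod_factorization (hf : IsRandomCompletelyMultiplicative μ f) (ω : Ω) {n : ℕ}
    (hn : 0 < n) : (f n ω : ℝ) = ∏ p ∈ n.primeFactors, (f p ω : ℝ) ^ n.factorization p := by
  have h1 : hf.toHom ω 0 n = f n ω := by rw [hf.toHom_apply ω 0 hn]; simp
  rw [← h1]
  conv_lhs => rw [← Nat.prod_factorization_pow_eq_self hn.ne']
  rw [Finsupp.prod, map_prod]
  refine Finset.prod_congr rfl fun p hp => ?_
  rw [map_pow, hf.toHom_apply ω 0 (Nat.prime_of_mem_primeFactors hp).pos]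
  simp

lemma ae_abs_eq_one (hf : IsRandomCompletelyMultiplicative μ f) :
    ∀ᵐ ω ∂μ, ∀ n : ℕ, 0 < n → |(f n ω : ℝ)| = 1 := by
  filter_upwards [hf.ae_eq_one_or] with ω hω n hn
  rw [hf.cast_eq_prod_factorization ω hn, Finset.abs_prod]
  refine Finset.prod_eq_one fun p hp => ?_
  rw [abs_pow]
  rcases hω ⟨p, Nat.prime_of_mem_primeFactors hp⟩ with h | h <;> simp [h]

lemma exists_odd_factorization {n : ℕ} (hn : 0 < n) (hsq : ¬ IsSquare n) :
    ∃ p ∈ n.primeFactors, Odd (n.factorization p) := by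
  by_contra! h
  apply hsq
  refine ⟨∏ p ∈ n.primeFactors, p ^ (n.factorization p / 2), ?_⟩
  conv_lhs => rw [← Nat.prod_factorization_pow_eq_self hn.ne']
  rw [Finsupp.prod, ← Finset.prod_mul_distrib]
  refine Finset.prod_congr rfl fun p hp => ?_
  have := Nat.not_odd_iff_even.1 (h p hp)
  rw [← pow_add]
  congr 1
  obtain ⟨k, hk⟩ := this
  omega

/-- Some prime divides n to an odd power, and by independence it contributes a factor of mean zero.
-/
lemma integral_eq_zero_of_not_isSquare (hf : IsRandomCompletelyMultiplicative μ f) {n : ℕ}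
    (hn : 0 < n) (hsq : ¬ IsSquare n) : ∫ ω, (f n ω : ℝ) ∂μ = 0 := by
  obtain ⟨q, hq, hodd⟩ := exists_odd_factorization hn hsq
  have hB : ∀ ω, (f n ω : ℝ) = ∏ p ∈ n.primeFactors.subtype Nat.Prime,
      (fun (p : Nat.Primes) (v : ℤ) => (v : ℝ) ^ n.factorization p) p (f p ω) := by
    intro ω
    rw [hf.cast_eq_prod_factorization ω hn]
    exact (Finset.prod_subtype_of_mem (fun p : ℕ => (f p ω : ℝ) ^ n.factorization p)
      fun p hp => Nat.prime_of_mem_primeFactors hp).symm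
  simp only [hB]
  have := hf.integral_prod_primes (n.primeFactors.subtype Nat.Prime)
    (fun (p : Nat.Primes) (v : ℤ) => (v : ℝ) ^ n.factorization p)
  refine this.trans ?_
  refine Finset.prod_eq_zero (i := ⟨q, Nat.prime_of_mem_primeFactors hq⟩)
    (Finset.mem_subtype.2 hq) ?_
  simp [hodd.neg_one_pow]

lemma integrable_cast (hf : IsRandomCompletelyMultiplicative μ f) {n : ℕ} (hn : 0 < n) :
    Integrable (fun ω => (f n ω : ℝ)) μ := by
  refine Integrable.of_bound
    ((measurable_of_countable _).comp (hf.measurable_of_pos hn)).aestronglyMeasurable 1 ?_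
  filter_upwards [hf.ae_abs_eq_one] with ω hω
  exact (hω n hn).le

/-- Second moment bound for a finite weighted sum of the values of `f`. -/
lemma integral_sum_sq_le (hf : IsRandomCompletelyMultiplicative μ f) (A : Finset ℕ)
    (hA : ∀ n ∈ A, 0 < n) (a : ℕ → ℝ) :
    ∫ ω, (∑ n ∈ A, (f n ω : ℝ) * a n) ^ 2 ∂μ ≤
      ∑ m ∈ A, ∑ n ∈ A, if IsSquare (m * n) then |a m| * |a n| else 0 := by
  have hexp : ∀ ω, (∑ n ∈ A, (f n ω : ℝ) * a n) ^ 2 =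
      ∑ m ∈ A, ∑ n ∈ A, (f (m * n) ω : ℝ) * (a m * a n) := by
    intro ω
    rw [sq, Finset.sum_mul_sum]
    refine Finset.sum_congr rfl fun m hm => Finset.sum_congr rfl fun n hn => ?_
    rw [hf.map_mul ω m n (hA m hm) (hA n hn)]
    push_cast; ring
  simp only [hexp]
  rw [integral_finsetSum _ fun m hm => integrable_finsetSum _ fun n hn =>
    (hf.integrable_cast (Nat.mul_pos (hA m hm) (hA n hn))).mul_const _]
  refine Finset.sum_le_sum fun m hm => ?_
  rw [integral_finsetSum _ fun n hn =>
    (hf.integrable_cast (Nat.mul_pos (hA m hm) (hA n hn))).mul_const _]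
  refine Finset.sum_le_sum fun n hn => ?_
  have hmn := Nat.mul_pos (hA m hm) (hA n hn)
  rw [integral_mul_const]
  split_ifs with h
  · rw [← abs_mul]
    refine (le_abs_self _).trans ?_
    rw [abs_mul]
    refine mul_le_of_le_one_left (abs_nonneg _) ?_
    refine (abs_integral_le_integral_abs).trans ?_
    have : (fun ω => |(f (m * n) ω : ℝ)|) =ᵐ[μ] fun _ => 1 := by
      filter_upwards [hf.ae_abs_eq_one] with ω hω using hω _ hmn
    rw [integral_congr_ae this]
    simp
  · rw [hf.integral_eq_zero_of_not_isSquare hmn h, zero_mul]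

end IsRandomCompletelyMultiplicative

/-! ### Moments of the quotient of two Euler products -/

/-- The quotient `(1 - v c_p(t)) / (1 - v c_p(s))` of Euler factors. -/
noncomputable def localRatio (s t : ℝ) (p : Nat.Primes) (v : ℤ) : ℝ :=
  (1 - v * primeWeight p t) / (1 - v * primeWeight p s)

section LocalMoments

variable {c d : ℝ}

/-- Here c = c_p(s) and c + d = c_p(t), and the bound 1/14 is p^(-1/2) at p = 196. The two values of
the quotient are 1 - d/(1-c) and 1 + d/(1+c); their asymmetry x - y is of second order, about 2cd,
and is the source of the drift. -/
lemma ratio_eqs (hc : 0 ≤ c) (hd : 0 ≤ d) (h : c + d ≤ 1 / 14) :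
    ∃ x y : ℝ, (1 - (c + d)) / (1 - c) = 1 - x ∧ (1 + (c + d)) / (1 + c) = 1 + y ∧
      0 ≤ y ∧ y ≤ d ∧ d ≤ x ∧ x ≤ 14 / 13 * d ∧ x - y ≤ 2.1 * (c * d) ∧
      2 * d ^ 2 ≤ x ^ 2 + y ^ 2 := by
  have h1 : 0 < 1 - c := by linarith
  have h2 : 0 < 1 + c := by linarith
  have hcd : 0 ≤ c * d := mul_nonneg hc hd
  refine ⟨d / (1 - c), d / (1 + c), by field_simp; ring, by field_simp; ring, by positivity,
    div_le_self hd (by linarith), ?_, ?_, ?_, ?_⟩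
  · rw [le_div_iff₀ h1]; nlinarith
  · rw [div_le_iff₀ h1]; nlinarith
  · rw [div_sub_div _ _ h1.ne' h2.ne', div_le_iff₀ (by positivity)]
    nlinarith [mul_nonneg hcd hc, mul_le_mul_of_nonneg_left (show c ≤ 1 / 14 by linarith) hc,
      mul_le_mul_of_nonneg_left
        (show c * c ≤ 1 / 196 by nlinarith) hcd]
  · have hs : 2 * d ≤ d / (1 - c) + d / (1 + c) := by
      rw [div_add_div _ _ h1.ne' h2.ne', le_div_iff₀ (by positivity)]
      nlinarith [mul_nonneg hcd hc]
    nlinarith [sq_nonneg (d / (1 - c) - d / (1 + c))]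

/-- To second order the k-th moment of the quotient is 1 + k(k-1)/2 · d² - k · cd. For k = 2, 3, 6
the coefficients of d² are 1, 3, 15; the constants 1.1, 2.7 and 20 here and below leave room for the
higher order terms. -/
lemma ratio_second_moment_le (hc : 0 ≤ c) (hd : 0 ≤ d) (h : c + d ≤ 1 / 14) :
    (((1 - (c + d)) / (1 - c)) ^ 2 + ((1 + (c + d)) / (1 + c)) ^ 2) / 2
      ≤ Real.exp (1.1 * d ^ 2) := by
  obtain ⟨x, y, hx, hy, hy0, hyd, hdx, hxd, hxy, hsq⟩ := ratio_eqs hc hd h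
  rw [hx, hy]
  refine le_trans ?_ (Real.add_one_le_exp _)
  nlinarith [pow_le_pow_left₀ hy0 hyd 2, pow_le_pow_left₀ (hd.trans hdx) hxd 2]

lemma ratio_third_moment_ge (hc : 0 ≤ c) (hd : 0 ≤ d) (h : c + d ≤ 1 / 14) :
    Real.exp (2.7 * d ^ 2 - 5 * (c * d)) ≤
      (((1 - (c + d)) / (1 - c)) ^ 3 + ((1 + (c + d)) / (1 + c)) ^ 3) / 2 := by
  obtain ⟨x, y, hx, hy, hy0, hyd, hdx, hxd, hxy, hsq⟩ := ratio_eqs hc hd h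
  rw [hx, hy]
  have hcd : 0 ≤ c * d := mul_nonneg hc hd
  have hc1 : c ≤ 1 / 14 := by linarith
  have hd1 : d ≤ 1 / 14 := by linarith
  have hcd1 : c * d ≤ 1 / 196 := by nlinarith
  have hd2 : d ^ 2 ≤ 1 / 196 := by nlinarith
  have hx1 : x ≤ 1 / 13 := by linarith
  have hcube : x ^ 3 - y ^ 3 ≤ (x - y) * (3 / 169) := by
    have h3 : x ^ 2 + x * y + y ^ 2 ≤ 3 / 169 := by
      have hyx : y ≤ 1 / 13 := by linarith
      have hx0 : 0 ≤ x := hd.trans hdx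
      nlinarith [mul_le_mul hx1 hyx hy0 (by norm_num), pow_le_pow_left₀ hx0 hx1 2,
        pow_le_pow_left₀ hy0 hyx 2]
    have : x ^ 3 - y ^ 3 = (x - y) * (x ^ 2 + x * y + y ^ 2) := by ring
    rw [this]
    exact mul_le_mul_of_nonneg_left h3 (by linarith)
  have hlow : 1 + (3 * d ^ 2 - 4 * (c * d)) ≤ ((1 - x) ^ 3 + (1 + y) ^ 3) / 2 := by
    nlinarith
  refine le_trans ?_ hlow
  have hw : 0 < 1 - (2.7 * d ^ 2 - 5 * (c * d)) := by nlinarith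
  have hexp : Real.exp (2.7 * d ^ 2 - 5 * (c * d)) ≤ (1 - (2.7 * d ^ 2 - 5 * (c * d)))⁻¹ := by
    rw [← neg_neg (2.7 * d ^ 2 - 5 * (c * d)), Real.exp_neg]
    refine inv_anti₀ (by linarith) ?_
    have := Real.add_one_le_exp (-(2.7 * d ^ 2 - 5 * (c * d)))
    linarith
  refine hexp.trans ((inv_le_iff_one_le_mul₀ hw).2 ?_)
  nlinarith [mul_nonneg hcd (sq_nonneg d), mul_le_mul_of_nonneg_left hd2 (sq_nonneg d),
    mul_le_mul_of_nonneg_left hcd1 hcd, sq_nonneg d]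

lemma ratio_sixth_moment_le (hc : 0 ≤ c) (hd : 0 ≤ d) (h : c + d ≤ 1 / 14) :
    (((1 - (c + d)) / (1 - c)) ^ 6 + ((1 + (c + d)) / (1 + c)) ^ 6) / 2
      ≤ Real.exp (20 * d ^ 2) := by
  obtain ⟨x, y, hx, hy, hy0, hyd, hdx, hxd, hxy, hsq⟩ := ratio_eqs hc hd h
  rw [hx, hy]
  refine le_trans ?_ (Real.add_one_le_exp _)
  have hx0 : 0 ≤ x := hd.trans hdx
  have hyx : y ≤ x := hyd.trans hdx
  have hx2 : x ^ 2 ≤ 196 / 169 * d ^ 2 := by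
    have := pow_le_pow_left₀ hx0 hxd 2
    nlinarith
  have hx1 : x ^ 2 ≤ 1 / 100 := by nlinarith
  have hy2 : y ^ 2 ≤ d ^ 2 := pow_le_pow_left₀ hy0 hyd 2
  have hy1 : y ^ 2 ≤ 1 / 100 := by nlinarith
  have h3 : y ^ 3 ≤ x ^ 3 := pow_le_pow_left₀ hy0 hyx 3
  have h5 : y ^ 5 ≤ x ^ 5 := pow_le_pow_left₀ hy0 hyx 5
  have hx4 : x ^ 4 ≤ x ^ 2 * (1 / 100) := by
    have : x ^ 4 = x ^ 2 * x ^ 2 := by ring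
    rw [this]; exact mul_le_mul_of_nonneg_left hx1 (sq_nonneg x)
  have hy4 : y ^ 4 ≤ y ^ 2 * (1 / 100) := by
    have : y ^ 4 = y ^ 2 * y ^ 2 := by ring
    rw [this]; exact mul_le_mul_of_nonneg_left hy1 (sq_nonneg y)
  have hx6 : x ^ 6 ≤ x ^ 4 * (1 / 100) := by
    have : x ^ 6 = x ^ 4 * x ^ 2 := by ring
    rw [this]; exact mul_le_mul_of_nonneg_left hx1 (by positivity)
  have hy6 : y ^ 6 ≤ y ^ 4 * (1 / 100) := by
    have : y ^ 6 = y ^ 4 * y ^ 2 := by ring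
    rw [this]; exact mul_le_mul_of_nonneg_left hy1 (by positivity)
  have e : ((1 - x) ^ 6 + (1 + y) ^ 6) / 2 = 1 + 3 * (y - x) + 15 / 2 * (x ^ 2 + y ^ 2)
      + 10 * (y ^ 3 - x ^ 3) + 15 / 2 * (x ^ 4 + y ^ 4) + 3 * (y ^ 5 - x ^ 5)
      + 1 / 2 * (x ^ 6 + y ^ 6) := by ring
  rw [e]
  linarith [sq_nonneg d]

end LocalMoments

lemma primeWeight_le_of_ge {p : Nat.Primes} (hp : 196 ≤ (p : ℕ)) {s : ℝ} (hs : 0 ≤ s) :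
    primeWeight p s ≤ 1 / 14 := by
  have hp' : (196 : ℝ) ≤ p := by exact_mod_cast hp
  calc primeWeight p s ≤ primeWeight p 0 := primeWeight_le hs
    _ = (Real.sqrt p)⁻¹ := by
      rw [primeWeight, Real.sqrt_eq_rpow, ← Real.rpow_neg (Nat.cast_nonneg _)]
      simp
    _ ≤ 1 / 14 := by
      rw [one_div]
      refine inv_anti₀ (by norm_num) (Real.le_sqrt_of_sq_le (by linarith))

/-- A lower bound for an upper tail probability from second, third and sixth moments. -/
lemma sq_div_le_measureReal_of_moments {Ω : Type*} [MeasurableSpace Ω] {μ : Measure Ω}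
    [IsProbabilityMeasure μ] {Z : Ω → ℝ} (hZ : Measurable Z) (hZ0 : 0 ≤ᵐ[μ] Z)
    {K m M : ℝ} (hK : 0 ≤ K)
    (h2 : Integrable (fun ω => Z ω ^ 2) μ) (h3 : Integrable (fun ω => Z ω ^ 3) μ)
    (h6 : Integrable (fun ω => Z ω ^ 6) μ) (hm : 0 < m) (hM : 0 < M)
    (hlow : m ≤ ∫ ω, Z ω ^ 3 ∂μ - K * ∫ ω, Z ω ^ 2 ∂μ) (hup : ∫ ω, Z ω ^ 6 ∂μ ≤ M) :
    m ^ 2 / M ≤ μ.real {ω | K ≤ Z ω} := by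
  have hA : MeasurableSet {ω | K ≤ Z ω} := measurableSet_le measurable_const hZ
  have hI : Integrable ({ω | K ≤ Z ω}.indicator fun _ => (1 : ℝ)) μ :=
    (integrable_const _).indicator hA
  -- Below K the cube is at most K Z². Above K, AM-GM splits Z³ · 1 with weights m/M and M/m, chosen
  -- so that the sixth moment uses up exactly half of m.
  have hpt : ∀ᵐ ω ∂μ, Z ω ^ 3 ≤ (K * Z ω ^ 2 + m / M / 2 * Z ω ^ 6) +
      M / m / 2 * {ω | K ≤ Z ω}.indicator (fun _ => (1 : ℝ)) ω := by
    filter_upwards [hZ0] with ω hω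
    have hω : 0 ≤ Z ω := hω
    by_cases h : K ≤ Z ω
    · rw [Set.indicator_of_mem (by exact h)]
      have hsq : 0 ≤ (m * Z ω ^ 3 - M) ^ 2 / (2 * m * M) := by positivity
      have e : (m * Z ω ^ 3 - M) ^ 2 / (2 * m * M)
          = m / M / 2 * Z ω ^ 6 - Z ω ^ 3 + M / m / 2 * 1 := by
        field_simp; ring
      nlinarith [mul_nonneg hK (sq_nonneg (Z ω))]
    · rw [Set.indicator_of_notMem (by exact h)]
      have h1 : Z ω ^ 3 ≤ K * Z ω ^ 2 := by
        have : Z ω ^ 3 = Z ω * Z ω ^ 2 := by ring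
        rw [this]
        exact mul_le_mul_of_nonneg_right (not_le.1 h).le (sq_nonneg _)
      have h2 : 0 ≤ m / M / 2 * Z ω ^ 6 := by positivity
      linarith
  have hint := integral_mono_ae h3
    (((h2.const_mul K).add (h6.const_mul (m / M / 2))).add (hI.const_mul (M / m / 2))) hpt
  simp only [Pi.add_apply] at hint
  rw [integral_add (f := fun ω => K * Z ω ^ 2 + m / M / 2 * Z ω ^ 6)
      ((h2.const_mul K).add (h6.const_mul _)) (hI.const_mul _),
    integral_add (h2.const_mul K) (h6.const_mul _), integral_const_mul, integral_const_mul,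
    integral_const_mul, integral_indicator_const _ hA, smul_eq_mul, mul_one] at hint
  have h6' := mul_le_mul_of_nonneg_left hup (show 0 ≤ m / M / 2 by positivity)
  have e : m / M / 2 * M = m / 2 := by field_simp
  have : m / 2 ≤ M / m / 2 * μ.real {ω | K ≤ Z ω} := by linarith
  rw [div_le_iff₀ hM]
  have e2 : M / m / 2 * μ.real {ω | K ≤ Z ω} * (2 * m) = μ.real {ω | K ≤ Z ω} * M := by
    field_simp
  nlinarith [mul_le_mul_of_nonneg_right this (show 0 ≤ 2 * m by positivity)]

/-- The primes in `[a, b)`. -/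
def primesIco (a b : ℕ) : Finset Nat.Primes := (Finset.Ico a b).subtype Nat.Prime

lemma mem_primesIco {a b : ℕ} {p : Nat.Primes} : p ∈ primesIco a b ↔ a ≤ p ∧ (p : ℕ) < b :=
  Finset.mem_subtype.trans Finset.mem_Ico

lemma prod_primesIco_zero {M : Type*} [CommMonoid M] {a b : ℕ} (h : a ≤ b)
    (g : Nat.Primes → M) :
    ∏ p ∈ primesIco 0 b, g p = (∏ p ∈ primesIco 0 a, g p) * ∏ p ∈ primesIco a b, g p := by
  rw [← Finset.prod_union]
  · congr 1
    ext p
    simp only [Finset.mem_union, mem_primesIco]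
    omega
  · rw [Finset.disjoint_left]
    intro p
    simp only [mem_primesIco]
    omega

lemma tendsto_primesIco : Tendsto (primesIco 0) atTop atTop := by
  refine tendsto_atTop.2 fun S => ?_
  filter_upwards [eventually_gt_atTop (S.sup fun p : Nat.Primes => (p : ℕ))] with b hb p hp
  rw [mem_primesIco]
  exact ⟨Nat.zero_le _, (Finset.le_sup (f := fun p : Nat.Primes => (p : ℕ)) hp).trans_lt hb⟩

/-- The product of `localRatio` over a finite set of primes, at a sample point. -/
noncomputable def blockRatio {Ω : Type*} (f : ℕ → Ω → ℤ) (B : Finset Nat.Primes) (s t : ℝ)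
    (ω : Ω) : ℝ := ∏ p ∈ B, localRatio s t p (f p ω)

namespace IsRandomCompletelyMultiplicative

variable {Ω : Type*} [MeasurableSpace Ω] {μ : Measure Ω} [IsProbabilityMeasure μ]
  {f : ℕ → Ω → ℤ}

omit [IsProbabilityMeasure μ] in
lemma measurable_prod_primes (hf : IsRandomCompletelyMultiplicative μ f) (B : Finset Nat.Primes)
    (φ : Nat.Primes → ℤ → ℝ) : Measurable fun ω => ∏ p ∈ B, φ p (f p ω) :=
  Finset.measurable_fun_prod B fun p _ =>
    (measurable_of_countable (φ p)).comp (hf.measurable_prime p)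

lemma integrable_prod_primes (hf : IsRandomCompletelyMultiplicative μ f) (B : Finset Nat.Primes)
    (φ : Nat.Primes → ℤ → ℝ) : Integrable (fun ω => ∏ p ∈ B, φ p (f p ω)) μ := by
  refine Integrable.of_bound (hf.measurable_prod_primes B φ).aestronglyMeasurable
    (∏ p ∈ B, max ‖φ p 1‖ ‖φ p (-1)‖) ?_
  filter_upwards [hf.ae_eq_one_or] with ω hω
  rw [norm_prod]
  refine Finset.prod_le_prod (fun _ _ => norm_nonneg _) fun p _ => ?_
  rcases hω p with h | h <;> simp [h]

lemma blockRatio_pow_integrable (hf : IsRandomCompletelyMultiplicative μ f)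
    (B : Finset Nat.Primes) (s t : ℝ) (k : ℕ) :
    Integrable (fun ω => blockRatio f B s t ω ^ k) μ := by
  simp only [blockRatio, ← Finset.prod_pow]
  exact hf.integrable_prod_primes B fun p v => localRatio s t p v ^ k

lemma integral_blockRatio_pow (hf : IsRandomCompletelyMultiplicative μ f)
    (B : Finset Nat.Primes) (s t : ℝ) (k : ℕ) :
    ∫ ω, blockRatio f B s t ω ^ k ∂μ =
      ∏ p ∈ B, (localRatio s t p 1 ^ k + localRatio s t p (-1) ^ k) / 2 := by
  simp only [blockRatio, ← Finset.prod_pow]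
  exact hf.integral_prod_primes B fun p v => localRatio s t p v ^ k

lemma localRatio_pos {s t : ℝ} (hs : 0 ≤ s) (ht : 0 ≤ t) (p : Nat.Primes) {v : ℤ}
    (hv : v = 1 ∨ v = -1) : 0 < localRatio s t p v := by
  have h1 := primeWeight_lt_one p hs
  have h2 := primeWeight_lt_one p ht
  have h3 := primeWeight_pos p s
  have h4 := primeWeight_pos p t
  rcases hv with rfl | rfl
  · refine div_pos ?_ ?_ <;> push_cast <;> linarith
  · refine div_pos ?_ ?_ <;> push_cast <;> linarith

/-- Lower bound for the probability that a block of Euler factors changes by a large ratio. -/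
lemma measureReal_blockRatio_ge (hf : IsRandomCompletelyMultiplicative μ f)
    {B : Finset Nat.Primes} (hB : ∀ p ∈ B, 196 ≤ (p : ℕ)) {s t : ℝ} (ht : 0 < t) (hts : t ≤ s)
    {K m : ℝ} (hK : 0 ≤ K) (hm : 0 < m)
    (h : m ≤ Real.exp (2.7 * ∑ p ∈ B, (primeWeight p t - primeWeight p s) ^ 2
        - 5 * ∑ p ∈ B, primeWeight p s * (primeWeight p t - primeWeight p s))
      - K * Real.exp (1.1 * ∑ p ∈ B, (primeWeight p t - primeWeight p s) ^ 2)) :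
    m ^ 2 / Real.exp (20 * ∑ p ∈ B, (primeWeight p t - primeWeight p s) ^ 2) ≤
      μ.real {ω | K ≤ blockRatio f B s t ω} := by
  have hr1 (p : Nat.Primes) : localRatio s t p 1 =
      (1 - (primeWeight p s + (primeWeight p t - primeWeight p s))) / (1 - primeWeight p s) := by
    simp [localRatio]
  have hr2 (p : Nat.Primes) : localRatio s t p (-1) =
      (1 + (primeWeight p s + (primeWeight p t - primeWeight p s))) / (1 + primeWeight p s) := by
    simp [localRatio]
  have hc (p : Nat.Primes) : 0 ≤ primeWeight p s := (primeWeight_pos p s).le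
  have hd (p : Nat.Primes) : 0 ≤ primeWeight p t - primeWeight p s :=
    sub_nonneg.2 (primeWeight_le hts)
  have hcd (p) (hp : p ∈ B) :
      primeWeight p s + (primeWeight p t - primeWeight p s) ≤ 1 / 14 := by
    have := primeWeight_le_of_ge (hB p hp) ht.le
    linarith
  have hpos (p : Nat.Primes) : 0 < localRatio s t p 1 ∧ 0 < localRatio s t p (-1) :=
    ⟨localRatio_pos (ht.le.trans hts) ht.le p (Or.inl rfl),
      localRatio_pos (ht.le.trans hts) ht.le p (Or.inr rfl)⟩
  refine sq_div_le_measureReal_of_moments (Z := blockRatio f B s t)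
    (hf.measurable_prod_primes B (localRatio s t)) ?_ hK
    (hf.blockRatio_pow_integrable B s t 2) (hf.blockRatio_pow_integrable B s t 3)
    (hf.blockRatio_pow_integrable B s t 6) hm (Real.exp_pos _) (h.trans (sub_le_sub ?_ ?_)) ?_
  · filter_upwards [hf.ae_eq_one_or] with ω hω
    exact Finset.prod_nonneg fun p _ =>
      (localRatio_pos (ht.le.trans hts) ht.le p (hω p)).le
  · rw [hf.integral_blockRatio_pow, Finset.mul_sum, Finset.mul_sum, ← Finset.sum_sub_distrib,
      Real.exp_sum]
    refine Finset.prod_le_prod (fun _ _ => (Real.exp_pos _).le) fun p hp => ?_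
    rw [hr1, hr2]
    exact ratio_third_moment_ge (hc p) (hd p) (hcd p hp)
  · refine mul_le_mul_of_nonneg_left ?_ hK
    rw [hf.integral_blockRatio_pow, Finset.mul_sum, Real.exp_sum]
    refine Finset.prod_le_prod (fun p _ => ?_) fun p hp => ?_
    · have h1 := (hpos p).1
      have h2 := (hpos p).2
      positivity
    rw [hr1, hr2]
    exact ratio_second_moment_le (hc p) (hd p) (hcd p hp)
  · rw [hf.integral_blockRatio_pow, Finset.mul_sum, Real.exp_sum]
    refine Finset.prod_le_prod (fun p _ => ?_) fun p hp => ?_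
    · have h1 := (hpos p).1
      have h2 := (hpos p).2
      positivity
    rw [hr1, hr2]
    exact ratio_sixth_moment_le (hc p) (hd p) (hcd p hp)

/-- For a suitable `l`, every sufficiently long block of primes makes the Euler product at
`s` exceed `16 / l` times the one at `l * s` with probability bounded below. -/
lemma exists_block_probability (hf : IsRandomCompletelyMultiplicative μ f) :
    ∃ l : ℝ, 0 < l ∧ l < 1 ∧ ∃ c : ℝ, 0 < c ∧ ∀ a : ℕ, 196 ≤ a → ∀ᶠ s in 𝓝[>] (0 : ℝ),
      ∀ᶠ b in atTop, c ≤ μ.real {ω | 16 / l ≤ blockRatio f (primesIco a b) s (l * s) ω} := by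
  obtain ⟨C₀, hC₀⟩ := exists_primeWeight_sums_bound
  set C := max C₀ 0 with hC
  have hC0 : 0 ≤ C := le_max_right _ _
  -- With l = exp (-L), L is chosen so that 1.6 q - 5 D - L ≥ 16 whenever q ≥ L - (C + 1) and D ≤ C.
  -- Then the third moment bound beats 16/l times the second moment bound by at least 1.
  set L : ℝ := (1.6 * (C + 1) + 5 * C + 16) / 0.6 with hL
  have hL0 : 0 < L := by positivity
  have hL1 : 0.6 * L = 1.6 * (C + 1) + 5 * C + 16 := by rw [hL]; field_simp
  refine ⟨Real.exp (-L), Real.exp_pos _, by rw [Real.exp_lt_one_iff]; linarith,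
    1 / Real.exp (20 * (L + C)), by positivity, fun a ha => ?_⟩
  set l := Real.exp (-L) with hl
  have hl0 : 0 < l := Real.exp_pos _
  have hl1 : l < 1 := by rw [hl, Real.exp_lt_one_iff]; linarith
  -- The variance over the block loses at most 1/2 to the primes below `a`, by continuity at s = 0,
  -- and at most 1/2 to those from `b` on, by summability. This is the extra 1 in C + 1.
  have hsmall : ∀ᶠ s in 𝓝[>] (0 : ℝ),
      ∑ p ∈ primesIco 0 a, (primeWeight p (l * s) - primeWeight p s) ^ 2 < 1 / 2 := by
    have hcont : Continuous fun s : ℝ =>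
        ∑ p ∈ primesIco 0 a, (primeWeight p (l * s) - primeWeight p s) ^ 2 := by
      refine continuous_finsetSum _ fun p _ => ?_
      exact (((continuous_primeWeight p).comp (continuous_const.mul continuous_id)).sub
        (continuous_primeWeight p)).pow 2
    have h0 := hcont.tendsto 0
    simp only [mul_zero, sub_self, ne_eq, OfNat.ofNat_ne_zero, not_false_eq_true, zero_pow,
      Finset.sum_const_zero] at h0
    exact (h0.mono_left nhdsWithin_le_nhds).eventually (gt_mem_nhds (by norm_num))
  filter_upwards [hC₀ l hl0 hl1, hsmall, self_mem_nhdsWithin] with s hs hsm hs0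
  have hs0 : 0 < s := hs0
  have hls : 0 < l * s := mul_pos hl0 hs0
  have hle : l * s ≤ s := by nlinarith
  have hQ := summable_primeWeight_sub_sq hs0 hls
  have hD := summable_primeWeight_mul_sub hs0 hls
  have htail := (hQ.hasSum.comp tendsto_primesIco).eventually
    (lt_mem_nhds (show ∑' p : Nat.Primes, (primeWeight p (l * s) - primeWeight p s) ^ 2 - 1 / 2
      < ∑' p : Nat.Primes, (primeWeight p (l * s) - primeWeight p s) ^ 2 by linarith))
  filter_upwards [htail, eventually_ge_atTop a] with b hb hab
  -- Sums are products in `Multiplicative ℝ`, so the splitting of products applies.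
  have hsplit : ∑ p ∈ primesIco 0 b, (primeWeight p (l * s) - primeWeight p s) ^ 2 =
      ∑ p ∈ primesIco 0 a, (primeWeight p (l * s) - primeWeight p s) ^ 2 +
      ∑ p ∈ primesIco a b, (primeWeight p (l * s) - primeWeight p s) ^ 2 :=
    prod_primesIco_zero (M := Multiplicative ℝ) hab _
  simp only [Function.comp_apply] at hb
  have hup : ∑ p ∈ primesIco a b, (primeWeight p (l * s) - primeWeight p s) ^ 2 ≤
      ∑' p : Nat.Primes, (primeWeight p (l * s) - primeWeight p s) ^ 2 :=
    hQ.sum_le_tsum _ fun p _ => sq_nonneg _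
  have hDup : ∑ p ∈ primesIco a b, primeWeight p s * (primeWeight p (l * s) - primeWeight p s) ≤
      ∑' p : Nat.Primes, primeWeight p s * (primeWeight p (l * s) - primeWeight p s) :=
    hD.sum_le_tsum _ fun p _ => mul_nonneg (primeWeight_pos p s).le
      (sub_nonneg.2 (primeWeight_le hle))
  have hq0 : 0 ≤ ∑ p ∈ primesIco a b, (primeWeight p (l * s) - primeWeight p s) ^ 2 :=
    Finset.sum_nonneg fun p _ => sq_nonneg _
  have hkey := hf.measureReal_blockRatio_ge (B := primesIco a b)
    (fun p hp => ha.trans (mem_primesIco.1 hp).1) hls hle (K := 16 / l) (m := 1)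
    (by positivity) one_pos
  have hCC : C₀ ≤ C := le_max_left _ _
  obtain ⟨hs1, hs2⟩ := hs
  rw [abs_le, hl, Real.log_exp, ← hl] at hs1
  set q := ∑ p ∈ primesIco a b, (primeWeight p (l * s) - primeWeight p s) ^ 2
  set D := ∑ p ∈ primesIco a b, primeWeight p s * (primeWeight p (l * s) - primeWeight p s)
  have hql : L - (C + 1) ≤ q := by linarith
  have hqu : q ≤ L + C := by linarith
  have hD' : D ≤ C := by linarith
  refine le_trans ?_ (hkey ?_)
  · rw [one_pow]
    exact one_div_le_one_div_of_le (Real.exp_pos _) (Real.exp_le_exp.2 (by linarith))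
  · have e1 : (16 : ℝ) / l = 16 * Real.exp L := by
      rw [hl, Real.exp_neg, div_inv_eq_mul]
    have e2 : Real.exp (2.7 * q - 5 * D)
        = Real.exp (1.6 * q - 5 * D - L) * Real.exp L * Real.exp (1.1 * q) := by
      rw [← Real.exp_add, ← Real.exp_add]; congr 1; ring
    have e3 : 17 ≤ Real.exp (1.6 * q - 5 * D - L) := by
      have := Real.add_one_le_exp (1.6 * q - 5 * D - L)
      linarith
    have e4 : 1 ≤ Real.exp L := Real.one_le_exp hL0.le
    have e5 : 1 ≤ Real.exp (1.1 * q) := Real.one_le_exp (by positivity)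
    rw [e1, e2]
    have e6 : 1 ≤ Real.exp L * Real.exp (1.1 * q) := one_le_mul_of_one_le_of_one_le e4 e5
    have e7 := mul_le_mul_of_nonneg_right e3 (show 0 ≤ Real.exp L * Real.exp (1.1 * q) by positivity)
    nlinarith

end IsRandomCompletelyMultiplicative

/-! ### Abel means against Euler products -/

/-- After division by the gcd, two coprime numbers have a square product, so each is a square. -/
lemma exists_eq_mul_sq_of_isSquare_mul {m n : ℕ} (hm : 0 < m) (h : IsSquare (m * n)) :
    ∃ d u v : ℕ, m = d * u ^ 2 ∧ n = d * v ^ 2 := by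
  obtain ⟨r, hr⟩ := h
  obtain ⟨g, a, b, hg, hab, rfl, rfl⟩ := Nat.exists_coprime' (m := m) (n := n)
    (Nat.gcd_pos_of_pos_left n hm)
  have hgr : g ∣ r := by
    rw [← Nat.pow_dvd_pow_iff two_ne_zero]
    exact ⟨a * b, by rw [sq r, ← hr]; ring⟩
  obtain ⟨k, rfl⟩ := hgr
  have hk : a * b = k ^ 2 := by
    have : g ^ 2 * (a * b) = g ^ 2 * k ^ 2 := by
      calc g ^ 2 * (a * b) = a * g * (b * g) := by ring
        _ = g * k * (g * k) := hr
        _ = g ^ 2 * k ^ 2 := by ring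
    exact Nat.eq_of_mul_eq_mul_left (by positivity) this
  have hu : IsUnit (gcd a b) := Nat.isUnit_iff.2 hab
  have hu' : IsUnit (gcd b a) := by
    rw [gcd_comm]; exact hu
  obtain ⟨u, hu⟩ := exists_eq_pow_of_mul_eq_pow hu hk
  obtain ⟨v, hv⟩ := exists_eq_pow_of_mul_eq_pow hu' ((mul_comm b a).trans hk)
  exact ⟨g, u, v, by rw [hu, mul_comm], by rw [hv, mul_comm]⟩

/-- Pairs of positive integers whose product is a square. -/
def squarePairs : Set (ℕ × ℕ) := {x | 0 < x.1 ∧ IsSquare (x.1 * x.2)}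

/-- Writing the pair as (du², dv²) turns its weight into (duv)^(-1-2s), which is summable over all
triples. This is the dominating function for the second moment of the discrepancy. -/
lemma summable_squarePairs {s : ℝ} (hs : 0 < s) :
    Summable (squarePairs.indicator fun x : ℕ × ℕ =>
      (x.1 : ℝ) ^ (-(1 / 2 + s)) * (x.2 : ℝ) ^ (-(1 / 2 + s))) := by
  rw [← summable_subtype_iff_indicator]
  have hex (x : squarePairs) : ∃ d : ℕ × ℕ × ℕ,
      x.1 = (d.1 * d.2.1 ^ 2, d.1 * d.2.2 ^ 2) := by
    obtain ⟨d, u, v, h1, h2⟩ := exists_eq_mul_sq_of_isSquare_mul x.2.1 x.2.2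
    exact ⟨(d, u, v), Prod.ext h1 h2⟩
  choose φ hφ using hex
  have hinj : Function.Injective φ := fun x y h => Subtype.ext (by rw [hφ x, hφ y, h])
  have h1 : Summable fun n : ℕ => (n : ℝ) ^ (-(1 + 2 * s)) :=
    Real.summable_nat_rpow.2 (by linarith)
  have hnn : (0 : ℕ → ℝ) ≤ fun n : ℕ => (n : ℝ) ^ (-(1 + 2 * s)) := fun n => by
    simp only [Pi.zero_apply]; positivity
  have h3 := h1.mul_of_nonneg (h1.mul_of_nonneg h1 hnn hnn) hnn
    (fun x => mul_nonneg (hnn _) (hnn _))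
  refine (h3.comp_injective hinj).congr fun x => ?_
  have hsq (k : ℕ) : (((k ^ 2 : ℕ) : ℝ)) ^ (-(1 / 2 + s)) = (k : ℝ) ^ (-(1 + 2 * s)) := by
    push_cast
    rw [← Real.rpow_natCast, ← Real.rpow_mul (Nat.cast_nonneg _)]
    congr 1; push_cast; ring
  have hx : 0 < (φ x).1 := by
    have := x.2.1
    rw [hφ x] at this
    exact Nat.pos_of_mul_pos_right this
  simp only [Function.comp_apply]
  rw [show x.1.1 = (φ x).1 * (φ x).2.1 ^ 2 by rw [hφ x], show x.1.2 = (φ x).1 * (φ x).2.2 ^ 2 by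
    rw [hφ x]]
  rw [Nat.cast_mul, Nat.cast_mul, Real.mul_rpow (Nat.cast_nonneg _) (Nat.cast_nonneg _),
    Real.mul_rpow (Nat.cast_nonneg _) (Nat.cast_nonneg _), hsq, hsq]
  have hd : (((φ x).1 : ℝ)) ^ (-(1 + 2 * s)) =
      ((φ x).1 : ℝ) ^ (-(1 / 2 + s)) * ((φ x).1 : ℝ) ^ (-(1 / 2 + s)) := by
    rw [← Real.rpow_add (by exact_mod_cast hx)]; congr 1; ring
  rw [hd]; ring

/-- The weights `1 - (n / (N + 1)) ^ s` of an Abel mean. -/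
noncomputable def abelWeight (s : ℝ) (N n : ℕ) : ℝ := 1 - ((n : ℝ) / (N + 1)) ^ s

lemma tendsto_abelWeight {s : ℝ} (hs : 0 < s) (n : ℕ) :
    Tendsto (fun N => abelWeight s N n) atTop (𝓝 1) := by
  have h1 : Tendsto (fun N : ℕ => (n : ℝ) / (N + 1)) atTop (𝓝 0) :=
    tendsto_const_nhds.div_atTop (tendsto_natCast_atTop_atTop.atTop_add tendsto_const_nhds)
  have h2 := h1.rpow_const (p := s) (Or.inr hs.le)
  rw [Real.zero_rpow hs.ne'] at h2
  simpa [abelWeight] using tendsto_const_nhds.sub h2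

lemma abelWeight_mem {s : ℝ} (hs : 0 < s) {N n : ℕ} (h : n ≤ N) :
    0 ≤ abelWeight s N n ∧ abelWeight s N n ≤ 1 := by
  have h0 : (0 : ℝ) ≤ (n : ℝ) / (N + 1) := by positivity
  have h1 : (n : ℝ) / (N + 1) ≤ 1 := by
    rw [div_le_one (by positivity)]
    have : (n : ℝ) ≤ N := by exact_mod_cast h
    linarith
  unfold abelWeight
  exact ⟨sub_nonneg.2 (Real.rpow_le_one h0 h1 hs.le), by
    have := Real.rpow_nonneg h0 s
    linarith⟩

open Classical in
/-- The discrepancy between Abel weights and the cutoff to `b`-smooth numbers. -/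
noncomputable def weightGap (s : ℝ) (b N n : ℕ) : ℝ :=
  abelWeight s N n - if n ∈ Nat.smoothNumbers b then 1 else 0

lemma abs_weightGap_le {s : ℝ} (hs : 0 < s) (b : ℕ) {N n : ℕ} (h : n ≤ N) :
    |weightGap s b N n| ≤ 1 := by
  obtain ⟨h0, h1⟩ := abelWeight_mem hs h
  unfold weightGap
  split_ifs <;> rw [abs_le] <;> constructor <;> linarith

lemma tendsto_weightGap {s : ℝ} (hs : 0 < s) {n : ℕ} (hn : 0 < n) :
    Tendsto (fun x : ℕ × ℕ => weightGap s x.1 x.2 n) (atTop ×ˢ atTop) (𝓝 0) := by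
  have h1 : Tendsto (fun x : ℕ × ℕ => abelWeight s x.2 n - 1) (atTop ×ˢ atTop) (𝓝 0) := by
    simpa using ((tendsto_abelWeight hs n).comp tendsto_snd).sub_const 1
  refine h1.congr' ?_
  filter_upwards [(eventually_gt_atTop n).prod_inl atTop] with x hx
  rw [weightGap, if_pos (Nat.mem_smoothNumbers_of_lt hn hx)]

/-- The second moment bound of the discrepancy tends to zero. -/
lemma tendsto_sum_weightGap {s : ℝ} (hs : 0 < s) :
    Tendsto (fun x : ℕ × ℕ => ∑ m ∈ Finset.Icc 1 x.2, ∑ n ∈ Finset.Icc 1 x.2,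
      if IsSquare (m * n) then |(m : ℝ) ^ (-(1 / 2 + s)) * weightGap s x.1 x.2 m| *
        |(n : ℝ) ^ (-(1 / 2 + s)) * weightGap s x.1 x.2 n| else 0) (atTop ×ˢ atTop) (𝓝 0) := by
  classical
  set W := squarePairs.indicator fun x : ℕ × ℕ =>
      (x.1 : ℝ) ^ (-(1 / 2 + s)) * (x.2 : ℝ) ^ (-(1 / 2 + s)) with hW
  have hWnn (y) : 0 ≤ W y := Set.indicator_nonneg (fun _ _ => by positivity) _
  -- Extension by zero outside the box puts all the sums on one index set, where dominated
  -- convergence applies.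
  set G : ℕ × ℕ → ℕ × ℕ → ℝ := fun x y =>
    if y ∈ Finset.Icc 1 x.2 ×ˢ Finset.Icc 1 x.2 then
      W y * (|weightGap s x.1 x.2 y.1| * |weightGap s x.1 x.2 y.2|) else 0 with hG
  have hDCT : Tendsto (fun x => ∑' y, G x y) (atTop ×ˢ atTop) (𝓝 (∑' _ : ℕ × ℕ, (0 : ℝ))) := by
    refine tendsto_tsum_of_dominated_convergence (bound := W) (summable_squarePairs hs) ?_ ?_
    · intro y
      by_cases hy : 0 < y.1 ∧ 0 < y.2
      · have h1 := ((tendsto_weightGap hs hy.1).abs.mul (tendsto_weightGap hs hy.2).abs).const_mul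
          (W y)
        simp only [abs_zero, mul_zero] at h1
        refine squeeze_zero (fun x => ?_) (fun x => ?_) h1
        · simp only [hG]; split_ifs
          · exact mul_nonneg (hWnn y) (by positivity)
          · exact le_rfl
        · simp only [hG]; split_ifs
          · exact le_rfl
          · exact mul_nonneg (hWnn y) (by positivity)
      · have : (fun x => G x y) = fun _ => 0 := by
          funext x
          refine if_neg ?_
          simp only [Finset.mem_product, Finset.mem_Icc]
          omega
        rw [this]; exact tendsto_const_nhds
    · refine Eventually.of_forall fun x y => ?_
      simp only [hG]
      split_ifs with h
      · simp only [Finset.mem_product, Finset.mem_Icc] at h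
        rw [Real.norm_of_nonneg (mul_nonneg (hWnn y) (by positivity))]
        exact mul_le_of_le_one_right (hWnn y)
          (mul_le_one₀ (abs_weightGap_le hs _ h.1.2) (abs_nonneg _) (abs_weightGap_le hs _ h.2.2))
      · simpa using hWnn y
  rw [tsum_zero] at hDCT
  refine hDCT.congr fun x => ?_
  rw [tsum_eq_sum (s := Finset.Icc 1 x.2 ×ˢ Finset.Icc 1 x.2) (fun y hy => if_neg hy),
    Finset.sum_product]
  refine Finset.sum_congr rfl fun m hm => Finset.sum_congr rfl fun n hn => ?_
  have hm1 := (Finset.mem_Icc.1 hm).1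
  simp only
  rw [if_pos (Finset.mem_product.2 ⟨hm, hn⟩)]
  by_cases hsq : IsSquare (m * n)
  · rw [if_pos hsq, hW, Set.indicator_of_mem (show (m, n) ∈ squarePairs from ⟨hm1, hsq⟩),
      abs_mul, abs_mul, abs_of_nonneg (Real.rpow_nonneg (Nat.cast_nonneg m) _),
      abs_of_nonneg (Real.rpow_nonneg (Nat.cast_nonneg n) _)]
    ring
  · rw [if_neg hsq, hW, Set.indicator_of_notMem (fun h => hsq h.2), zero_mul]

/-- The Abel mean `∑_{n ≤ N} f(n) n^(-1/2-s) (1 - (n/(N+1))^s)`. -/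
noncomputable def abelSum {Ω : Type*} (f : ℕ → Ω → ℤ) (s : ℝ) (N : ℕ) (ω : Ω) : ℝ :=
  ∑ n ∈ Finset.Icc 1 N, (f n ω : ℝ) * ((n : ℝ) ^ (-(1 / 2 + s)) * abelWeight s N n)

/-- The Euler product over primes less than `b`. -/
noncomputable def eulerProd {Ω : Type*} (f : ℕ → Ω → ℤ) (s : ℝ) (b : ℕ) (ω : Ω) : ℝ :=
  ∏ p ∈ primesIco 0 b, (1 - f p ω * primeWeight p s)⁻¹

namespace IsRandomCompletelyMultiplicative

variable {Ω : Type*} [MeasurableSpace Ω] {μ : Measure Ω} [IsProbabilityMeasure μ]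
  {f : ℕ → Ω → ℤ}

open Classical in
/-- The Euler product is uniformly approximated by finite sums over smooth numbers. -/
lemma eventually_abs_smooth_sum_sub_eulerProd_le (hf : IsRandomCompletelyMultiplicative μ f)
    {s : ℝ} (hs : 0 < s) (b : ℕ) {ε : ℝ} (hε : 0 < ε) :
    ∀ᶠ N in atTop, ∀ᵐ ω ∂μ, |∑ n ∈ Finset.Icc 1 N, (f n ω : ℝ) * ((n : ℝ) ^ (-(1 / 2 + s)) *
      if n ∈ Nat.smoothNumbers b then 1 else 0) - eulerProd f s b ω| ≤ ε := by
  set u : ℕ → ℝ := (Nat.smoothNumbers b).indicator fun n => (n : ℝ) ^ (-(1 / 2 + s)) with hu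
  have hlt {ω} (hω : ∀ n : ℕ, 0 < n → |(f n ω : ℝ)| = 1) {p : ℕ} (hp : p.Prime) :
      ‖(hf.toHom ω (1 / 2 + s) : ℕ →* ℝ) p‖ < 1 := by
    change ‖hf.toHom ω (1 / 2 + s) p‖ < 1
    rw [hf.toHom_apply ω _ hp.pos, norm_mul, Real.norm_eq_abs, hω p hp.pos, one_mul,
      Real.norm_of_nonneg (by positivity)]
    exact primeWeight_lt_one ⟨p, hp⟩ hs.le
  have hpos {n : ℕ} (hn : n ∈ Nat.smoothNumbers b) : 0 < n :=
    Nat.pos_of_ne_zero (Nat.ne_zero_of_mem_smoothNumbers hn)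
  have hnorm {ω} (hω : ∀ n : ℕ, 0 < n → |(f n ω : ℝ)| = 1) (n : ℕ) :
      ‖(Nat.smoothNumbers b).indicator (hf.toHom ω (1 / 2 + s)) n‖ = u n := by
    by_cases hn : n ∈ Nat.smoothNumbers b
    · rw [hu, Set.indicator_of_mem hn, Set.indicator_of_mem hn, hf.toHom_apply ω _ (hpos hn),
        norm_mul, Real.norm_eq_abs, hω n (hpos hn), one_mul, Real.norm_of_nonneg (by positivity)]
    · rw [hu, Set.indicator_of_notMem hn, Set.indicator_of_notMem hn, norm_zero]
  -- Since |f(n)| = 1 almost surely, `u` is deterministic: one sample point gives its summability,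
  -- and its tail then bounds the error uniformly in ω.
  have hsu : Summable u := by
    obtain ⟨ω, hω⟩ := hf.ae_abs_eq_one.exists
    have h1 := (EulerProduct.summable_and_hasSum_smoothNumbers_prod_primesBelow_geometric
      (f := (hf.toHom ω (1 / 2 + s) : ℕ →* ℝ)) (fun hp => hlt hω hp) b).1
    have h2 : Summable ((Nat.smoothNumbers b).indicator (hf.toHom ω (1 / 2 + s))) :=
      summable_subtype_iff_indicator.1 h1.of_norm
    simpa only [hnorm hω] using h2.norm
  have htail := (tendsto_order.1 (tendsto_sum_nat_add u)).2 ε hε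
  filter_upwards [(tendsto_add_atTop_nat 1).eventually htail] with N hN
  filter_upwards [hf.ae_abs_eq_one] with ω hω
  have h1 := (EulerProduct.summable_and_hasSum_smoothNumbers_prod_primesBelow_geometric
      (f := (hf.toHom ω (1 / 2 + s) : ℕ →* ℝ)) (fun hp => hlt hω hp) b).2
  have hprod : ∏ p ∈ Nat.primesBelow b, (1 - (hf.toHom ω (1 / 2 + s) : ℕ →* ℝ) p)⁻¹
      = eulerProd f s b ω := by
    have e : Nat.primesBelow b = (Finset.Ico 0 b).filter Nat.Prime := by
      rw [Nat.primesBelow, Finset.range_eq_Ico]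
    rw [e, eulerProd, primesIco, ← Finset.prod_subtype_eq_prod_filter]
    refine Finset.prod_congr rfl fun p _ => ?_
    change (1 - hf.toHom ω (1 / 2 + s) (p : ℕ))⁻¹ = _
    rw [hf.toHom_apply ω _ p.2.pos]
    rfl
  rw [hprod] at h1
  set v := (Nat.smoothNumbers b).indicator (hf.toHom ω (1 / 2 + s)) with hv
  have h2 : HasSum v (eulerProd f s b ω) := hasSum_subtype_iff_indicator.1 h1
  have hsum : ∑ n ∈ Finset.Icc 1 N, (f n ω : ℝ) * ((n : ℝ) ^ (-(1 / 2 + s)) *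
      if n ∈ Nat.smoothNumbers b then 1 else 0) = ∑ n ∈ Finset.range (N + 1), v n := by
    rw [Finset.range_eq_Ico, Finset.sum_eq_sum_Ico_succ_bot (Nat.succ_pos N)]
    have hv0 : v 0 = 0 := by simp [hv]
    rw [hv0, zero_add]
    refine Finset.sum_congr (by ext; simp) fun n hn => ?_
    have hn1 : 0 < n := by
      simp only [Finset.mem_Ico] at hn; omega
    by_cases h : n ∈ Nat.smoothNumbers b
    · rw [if_pos h, hv, Set.indicator_of_mem h, hf.toHom_apply ω _ hn1, mul_one]
    · rw [if_neg h, hv, Set.indicator_of_notMem h, mul_zero, mul_zero]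
  have hsplit := h2.summable.sum_add_tsum_nat_add (N + 1)
  rw [h2.tsum_eq] at hsplit
  rw [hsum, ← hsplit, sub_add_cancel_left, abs_neg]
  have hsv : Summable fun i => ‖v (i + (N + 1))‖ := by
    simp only [hv, hnorm hω]
    exact (summable_nat_add_iff (N + 1)).2 hsu
  refine (norm_tsum_le_tsum_norm hsv).trans ?_
  simp only [hv, hnorm hω]
  exact hN.le

/-- The Abel means converge in probability to the Euler product. -/
lemma eventually_measureReal_abelSum_sub_eulerProd (hf : IsRandomCompletelyMultiplicative μ f)
    {s : ℝ} (hs : 0 < s) {ε : ℝ} (hε : 0 < ε) :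
    ∀ᶠ b in atTop, ∀ᶠ N in atTop,
      μ.real {ω | ε < |abelSum f s N ω - eulerProd f s b ω|} ≤ ε := by
  classical
  -- Chebyshev at level ε/2 needs a second moment below ε(ε/2)²; the other ε/2 covers the smooth sum
  -- against the Euler product.
  have hev := ((tendsto_order.1 (tendsto_sum_weightGap hs)).2 (ε * (ε / 2) ^ 2)
    (by positivity)).curry
  filter_upwards [hev] with b hb
  filter_upwards [hb, hf.eventually_abs_smooth_sum_sub_eulerProd_le hs b (half_pos hε)]
    with N hN hae
  set X : Ω → ℝ := fun ω => ∑ n ∈ Finset.Icc 1 N,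
    (f n ω : ℝ) * ((n : ℝ) ^ (-(1 / 2 + s)) * weightGap s b N n) with hX
  have hXle := (hf.integral_sum_sq_le (Finset.Icc 1 N) (fun n hn => (Finset.mem_Icc.1 hn).1)
    (fun n => (n : ℝ) ^ (-(1 / 2 + s)) * weightGap s b N n)).trans hN.le
  have hXm : Measurable X := Finset.measurable_fun_sum _ fun n hn =>
    ((measurable_of_countable _).comp (hf.measurable_of_pos (Finset.mem_Icc.1 hn).1)).mul_const _
  have hXint : Integrable (fun ω => X ω ^ 2) μ := by
    refine Integrable.of_bound (hXm.pow_const 2).aestronglyMeasurable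
      ((∑ n ∈ Finset.Icc 1 N, |(n : ℝ) ^ (-(1 / 2 + s)) * weightGap s b N n|) ^ 2) ?_
    filter_upwards [hf.ae_abs_eq_one] with ω hω
    rw [norm_pow]
    refine pow_le_pow_left₀ (norm_nonneg _) ((norm_sum_le _ _).trans ?_) 2
    refine Finset.sum_le_sum fun n hn => ?_
    rw [norm_mul, Real.norm_eq_abs, hω n (Finset.mem_Icc.1 hn).1, one_mul, Real.norm_eq_abs]
  have hmarkov := mul_meas_ge_le_integral_of_nonneg (μ := μ)
    (Eventually.of_forall fun ω => sq_nonneg (X ω)) hXint ((ε / 2) ^ 2)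
  have hle : μ.real {ω | ε < |abelSum f s N ω - eulerProd f s b ω|} ≤
      μ.real {ω | (ε / 2) ^ 2 ≤ X ω ^ 2} := by
    refine ENNReal.toReal_mono (measure_ne_top _ _) (measure_mono_ae ?_)
    filter_upwards [hae] with ω hω h
    have h : ε < |abelSum f s N ω - eulerProd f s b ω| := h
    change (ε / 2) ^ 2 ≤ X ω ^ 2
    have hdec : X ω = abelSum f s N ω - ∑ n ∈ Finset.Icc 1 N, (f n ω : ℝ) *
        ((n : ℝ) ^ (-(1 / 2 + s)) * if n ∈ Nat.smoothNumbers b then 1 else 0) := by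
      rw [hX, abelSum, ← Finset.sum_sub_distrib]
      refine Finset.sum_congr rfl fun n _ => ?_
      rw [weightGap]; ring
    have htri : |abelSum f s N ω - eulerProd f s b ω| ≤ |X ω| + ε / 2 := by
      refine le_trans ?_ (add_le_add le_rfl hω)
      rw [hdec]
      exact abs_sub_le _ _ _
    rw [← sq_abs (X ω)]
    exact pow_le_pow_left₀ (by positivity) (by linarith) 2
  have h4 : (ε / 2) ^ 2 * μ.real {ω | (ε / 2) ^ 2 ≤ X ω ^ 2} ≤ (ε / 2) ^ 2 * ε := by
    linarith
  exact hle.trans (le_of_mul_le_mul_left h4 (by positivity))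

/-- The Euler product is rarely small, because its reciprocal has mean one. -/
lemma measureReal_eulerProd_lt_le (hf : IsRandomCompletelyMultiplicative μ f) {s : ℝ}
    (hs : 0 ≤ s) (b : ℕ) {η : ℝ} (hη : 0 < η) :
    μ.real {ω | eulerProd f s b ω < η} ≤ η := by
  set Y : Ω → ℝ := fun ω => ∏ p ∈ primesIco 0 b, (1 - f p ω * primeWeight p s) with hY
  have hint : ∫ ω, Y ω ∂μ = 1 := by
    refine (hf.integral_prod_primes (primesIco 0 b) fun p v => 1 - v * primeWeight p s).trans ?_
    refine Finset.prod_eq_one fun p _ => ?_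
    push_cast; ring
  have hYpos : ∀ᵐ ω ∂μ, 0 < Y ω := by
    filter_upwards [hf.ae_eq_one_or] with ω hω
    refine Finset.prod_pos fun p _ => ?_
    have h1 := primeWeight_lt_one p hs
    have h2 := primeWeight_pos p s
    rcases hω p with h | h <;> rw [h] <;> push_cast <;> linarith
  have hmarkov := mul_meas_ge_le_integral_of_nonneg (μ := μ) (f := Y)
    (hYpos.mono fun ω h => h.le)
    (hf.integrable_prod_primes (primesIco 0 b) fun p v => 1 - v * primeWeight p s) η⁻¹
  rw [hint] at hmarkov
  have hle : μ.real {ω | eulerProd f s b ω < η} ≤ μ.real {ω | η⁻¹ ≤ Y ω} := by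
    refine ENNReal.toReal_mono (measure_ne_top _ _) (measure_mono_ae ?_)
    filter_upwards [hYpos] with ω hω h
    have h : eulerProd f s b ω < η := h
    rw [eulerProd, Finset.prod_inv_distrib] at h
    exact (inv_lt_comm₀ hω hη).1 h |>.le
  refine hle.trans ?_
  rwa [inv_mul_le_iff₀ hη, mul_one] at hmarkov

end IsRandomCompletelyMultiplicative

/-! ### Independent blocks, summation by parts and sign changes -/

/-- Events depending on pairwise disjoint blocks of an independent family are independent. -/
lemma iIndepSet_of_disjoint_blocks {Ω ι : Type*} [mΩ : MeasurableSpace Ω] {μ : Measure Ω}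
    {m : ι → MeasurableSpace Ω} (hle : ∀ i, m i ≤ mΩ) (hm : iIndep m μ) {B : ℕ → Set ι}
    (hB : Pairwise fun j k => Disjoint (B j) (B k)) {A : ℕ → Set Ω}
    (hA : ∀ k, MeasurableSet[⨆ i ∈ B k, m i] (A k)) : iIndepSet A μ := by
  have := hm.isProbabilityMeasure
  have hsup (k : ℕ) : ⨆ i ∈ B k, m i ≤ mΩ := iSup₂_le fun i _ => hle i
  refine (iIndepSet_iff_meas_biInter fun k => hsup k _ (hA k)).2 fun S => ?_
  induction S using Finset.induction_on with
  | empty => simp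
  | insert k S hk ih =>
    rw [Finset.prod_insert hk, ← ih, Finset.set_biInter_insert]
    have hd : Disjoint (B k) (⋃ j ∈ S, B j) := by
      refine Set.disjoint_iUnion₂_right.2 fun j hj => hB ?_
      rintro rfl
      exact hk hj
    refine (Indep_iff _ _ μ).1 (indep_iSup_of_disjoint hle hm hd) _ _ (hA k) ?_
    refine Finset.measurableSet_biInter _ fun j hj => ?_
    have hmono : ⨆ i ∈ B j, m i ≤ ⨆ i ∈ ⋃ j ∈ S, B j, m i :=
      biSup_mono fun i hi => Set.mem_biUnion hj hi
    exact hmono _ (hA j)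

/-- Summation by parts for Abel means. -/
lemma sum_mul_sub_eq_sum_partial_sums (x y : ℕ → ℝ) (N : ℕ) :
    ∑ n ∈ Finset.Icc 1 N, x n * (y n - y (N + 1)) =
      ∑ n ∈ Finset.Icc 1 N, (∑ k ∈ Finset.Icc 1 n, x k) * (y n - y (n + 1)) := by
  induction N with
  | zero => simp
  | succ N ih =>
    rw [Finset.sum_Icc_succ_top (by omega) (fun n => (∑ k ∈ Finset.Icc 1 n, x k) *
      (y n - y (n + 1))), ← ih, Finset.sum_Icc_succ_top (by omega),
      Finset.sum_Icc_succ_top (by omega) x, add_mul, Finset.sum_mul, ← add_assoc,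
      ← Finset.sum_add_distrib]
    congr 1
    exact Finset.sum_congr rfl fun n _ => by ring

/-- The kernel `(n^(-s) - (n+1)^(-s)) / s`. -/
noncomputable def abelKernel (s : ℝ) (n : ℕ) : ℝ :=
  ((n : ℝ) ^ (-s) - ((n + 1 : ℕ) : ℝ) ^ (-s)) / s

/-- The factor 1/s in the kernel is what gives this form, and with it monotonicity in s: for x ≥ 1
the integrand decreases in s. -/
lemma abelKernel_eq_integral {s : ℝ} (hs : 0 < s) {n : ℕ} (hn : 0 < n) :
    abelKernel s n = ∫ x in (n : ℝ)..((n + 1 : ℕ) : ℝ), x ^ (-s - 1) := by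
  have hn' : (0 : ℝ) < n := by exact_mod_cast hn
  have h0 : (0 : ℝ) ∉ Set.uIcc (n : ℝ) ((n + 1 : ℕ) : ℝ) := by
    rw [Set.uIcc_of_le (by push_cast; linarith)]
    exact fun h => absurd h.1 (by linarith)
  rw [integral_rpow (Or.inr ⟨by linarith, h0⟩), abelKernel, sub_add_cancel, div_neg, ← neg_div,
    neg_sub]

lemma intervalIntegrable_rpow_succ {n : ℕ} (hn : 0 < n) (r : ℝ) :
    IntervalIntegrable (fun x : ℝ => x ^ r) volume (n : ℝ) ((n + 1 : ℕ) : ℝ) := by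
  have hn' : (0 : ℝ) < n := by exact_mod_cast hn
  refine intervalIntegral.intervalIntegrable_rpow (Or.inr ?_)
  rw [Set.uIcc_of_le (by push_cast; linarith)]
  exact fun h => absurd h.1 (by linarith)

lemma abelKernel_anti {s t : ℝ} (ht : 0 < t) (hts : t ≤ s) {n : ℕ} (hn : 0 < n) :
    abelKernel s n ≤ abelKernel t n := by
  rw [abelKernel_eq_integral (ht.trans_le hts) hn, abelKernel_eq_integral ht hn]
  refine intervalIntegral.integral_mono_on (by push_cast; linarith)
    (intervalIntegrable_rpow_succ hn _) (intervalIntegrable_rpow_succ hn _) fun x hx => ?_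
  have hx1 : 1 ≤ x := le_trans (by exact_mod_cast hn) hx.1
  exact Real.rpow_le_rpow_of_exponent_le hx1 (by linarith)

lemma abelKernel_nonneg {s : ℝ} (hs : 0 < s) {n : ℕ} (hn : 0 < n) : 0 ≤ abelKernel s n := by
  have hn' : (0 : ℝ) < n := by exact_mod_cast hn
  refine div_nonneg (sub_nonneg.2 ?_) hs.le
  exact Real.rpow_le_rpow_of_nonpos hn' (by push_cast; linarith) (by linarith)

lemma abelKernel_le_one {s : ℝ} (hs : 0 < s) {n : ℕ} (hn : 0 < n) : abelKernel s n ≤ 1 := by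
  have hn' : (0 : ℝ) < n := by exact_mod_cast hn
  rw [abelKernel_eq_integral hs hn]
  have h1 : ∫ x in (n : ℝ)..((n + 1 : ℕ) : ℝ), x ^ (-s - 1) ≤
      ∫ _ in (n : ℝ)..((n + 1 : ℕ) : ℝ), (1 : ℝ) := by
    refine intervalIntegral.integral_mono_on (by push_cast; linarith)
      (intervalIntegrable_rpow_succ hn _) intervalIntegrable_const fun x hx => ?_
    have hx1 : 1 ≤ x := le_trans (by exact_mod_cast hn) hx.1
    exact Real.rpow_le_one_of_one_le_of_nonpos hx1 (by linarith)
  simpa using h1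

/-- The weight 1 - (n/(N+1))^s amounts to subtracting (N+1)^(-s) from n^(-s), which is why no
boundary term appears. -/
lemma abelSum_div_eq {Ω : Type*} (f : ℕ → Ω → ℤ) {s : ℝ} (N : ℕ) (ω : Ω) :
    abelSum f s N ω / s =
      ∑ n ∈ Finset.Icc 1 N, partialSum (fun n => f n ω) n * abelKernel s n := by
  have h := sum_mul_sub_eq_sum_partial_sums (fun n => (f n ω : ℝ) / Real.sqrt n)
    (fun n => (n : ℝ) ^ (-s)) N
  have hl : abelSum f s N ω = ∑ n ∈ Finset.Icc 1 N, (f n ω : ℝ) / Real.sqrt n *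
      ((n : ℝ) ^ (-s) - ((N + 1 : ℕ) : ℝ) ^ (-s)) := by
    refine Finset.sum_congr rfl fun n hn => ?_
    have hn : (0 : ℝ) < n := by exact_mod_cast (Finset.mem_Icc.1 hn).1
    have e1 : (n : ℝ) ^ (-(1 / 2 + s)) = (Real.sqrt n)⁻¹ * (n : ℝ) ^ (-s) := by
      rw [Real.sqrt_eq_rpow, ← Real.rpow_neg hn.le, ← Real.rpow_add hn]; congr 1; ring
    have e2 : (n : ℝ) ^ (-s) * ((n : ℝ) / (N + 1)) ^ s = ((N + 1 : ℕ) : ℝ) ^ (-s) := by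
      have : (n : ℝ) ^ s ≠ 0 := (Real.rpow_pos_of_pos hn s).ne'
      push_cast
      rw [Real.div_rpow hn.le (by positivity), Real.rpow_neg hn.le,
        Real.rpow_neg (by positivity)]
      field_simp
    rw [abelWeight, e1, ← e2]; ring
  rw [hl, h, Finset.sum_div]
  refine Finset.sum_congr rfl fun n _ => ?_
  rw [abelKernel, partialSum, Nat.floor_natCast]
  ring

/-- A sequence of Abel means that is infinitely often large and fails to be monotone by a
factor of two forces infinitely many sign changes. -/
lemma changesSignInfinitelyOften_of_frequently (S : ℝ → ℝ) (s t : ℕ → ℝ) (N : ℕ → ℕ)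
    (ht : ∀ k, 0 < t k) (hts : ∀ k, t k ≤ s k) (hN : ∀ k, k ≤ N k)
    (h : ∃ᶠ k : ℕ in atTop,
      (k : ℝ) ≤ ∑ n ∈ Finset.Icc 1 (N k), S n * abelKernel (s k) n ∧
      2 * ∑ n ∈ Finset.Icc 1 (N k), S n * abelKernel (t k) n ≤
        ∑ n ∈ Finset.Icc 1 (N k), S n * abelKernel (s k) n) :
    ChangesSignInfinitelyOften S := by
  by_contra hcon
  unfold ChangesSignInfinitelyOften at hcon
  push Not at hcon
  obtain ⟨X, hX⟩ := hcon
  obtain ⟨m, hm⟩ := exists_nat_ge X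
  have hsign : (∀ n : ℕ, m ≤ n → 0 ≤ S n) ∨ (∀ n : ℕ, m ≤ n → S n ≤ 0) := by
    by_contra! hc
    obtain ⟨⟨i, hi, hi0⟩, ⟨j, hj, hj0⟩⟩ := hc
    have hXi : X ≤ i := hm.trans (by exact_mod_cast hi)
    have hXj : X ≤ j := hm.trans (by exact_mod_cast hj)
    have hneg : S i * S j < 0 := mul_neg_of_neg_of_pos hi0 hj0
    rcases lt_trichotomy i j with hij | rfl | hij
    · linarith [hX i j hXi (by exact_mod_cast hij)]
    · linarith
    · linarith [hX j i hXj (by exact_mod_cast hij), mul_comm (S i) (S j)]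
  set C := ∑ n ∈ Finset.Icc 1 m, |S n| with hC
  have hC0 : 0 ≤ C := Finset.sum_nonneg fun n _ => abs_nonneg _
  -- If the tail terms are nonnegative, monotonicity and the factor two bound the tail at `s k` by
  -- 3C, so k ≤ 4C; if they are nonpositive, k ≤ C.
  obtain ⟨k₀, hk₀⟩ := exists_nat_gt (4 * C)
  obtain ⟨k, hk, hk1, hk2⟩ := (frequently_atTop.1 h) (max k₀ m)
  have hkC : 4 * C < k := hk₀.trans_le (by exact_mod_cast (le_max_left _ _).trans hk)
  have hmN : m ≤ N k := ((le_max_right _ _).trans hk).trans (hN k)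
  have hsplit (r : ℝ) : ∑ n ∈ Finset.Icc 1 (N k), S n * abelKernel r n =
      ∑ n ∈ Finset.Icc 1 m, S n * abelKernel r n +
        ∑ n ∈ Finset.Ioc m (N k), S n * abelKernel r n := by
    have e (j : ℕ) : Finset.Icc 1 j = Finset.Ioc 0 j := by ext; simp [Nat.succ_le_iff]
    rw [e, e]
    exact (Finset.sum_Ioc_consecutive _ (Nat.zero_le m) hmN).symm
  have hhead {r : ℝ} (hr : 0 < r) : |∑ n ∈ Finset.Icc 1 m, S n * abelKernel r n| ≤ C := by
    refine (Finset.abs_sum_le_sum_abs _ _).trans (Finset.sum_le_sum fun n hn => ?_)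
    have hn := (Finset.mem_Icc.1 hn).1
    rw [abs_mul, abs_of_nonneg (abelKernel_nonneg hr hn)]
    exact mul_le_of_le_one_right (abs_nonneg _) (abelKernel_le_one hr hn)
  have hs : 0 < s k := (ht k).trans_le (hts k)
  have hhs := abs_le.1 (hhead hs)
  have hht := abs_le.1 (hhead (ht k))
  rw [hsplit] at hk1
  rw [hsplit, hsplit] at hk2
  rcases hsign with hpos | hneg
  · have hmono : ∑ n ∈ Finset.Ioc m (N k), S n * abelKernel (s k) n ≤
        ∑ n ∈ Finset.Ioc m (N k), S n * abelKernel (t k) n := by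
      refine Finset.sum_le_sum fun n hn => ?_
      have hn := (Finset.mem_Ioc.1 hn).1
      exact mul_le_mul_of_nonneg_left (abelKernel_anti (ht k) (hts k) (by omega))
        (hpos n hn.le)
    linarith
  · have hle : ∑ n ∈ Finset.Ioc m (N k), S n * abelKernel (s k) n ≤ 0 := by
      refine Finset.sum_nonpos fun n hn => ?_
      have hn := (Finset.mem_Ioc.1 hn).1
      exact mul_nonpos_of_nonpos_of_nonneg (hneg n hn.le) (abelKernel_nonneg hs (by omega))
    linarith

/-! ### Comparison at a single scale -/

/-- Passing from s to the smaller t raises the weight, so the quotient is at most 1 for the sign +1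
and at least 1 for -1. The worst case is deterministic. -/
lemma localRatio_one_le {s t : ℝ} (ht : 0 ≤ t) (hts : t ≤ s) (p : Nat.Primes) {v : ℤ}
    (hv : v = 1 ∨ v = -1) : localRatio s t p 1 ≤ localRatio s t p v := by
  rcases hv with rfl | rfl
  · exact le_rfl
  · have h1 := primeWeight_lt_one p (ht.trans hts)
    have h2 := primeWeight_le (p := p) hts
    have h3 := primeWeight_pos p s
    unfold localRatio
    push_cast
    rw [one_mul, one_mul, div_le_div_iff₀ (by linarith) (by linarith)]
    nlinarith

/-- The worst case, all signs +1, is a finite product tending to 1 as s → 0. Hence primes used at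
earlier scales cost at most a factor 2, whatever their signs. -/
lemma eventually_half_le_blockRatio {Ω : Type*} (f : ℕ → Ω → ℤ) (B : Finset Nat.Primes) {l : ℝ}
    (hl0 : 0 < l) (hl1 : l < 1) : ∀ᶠ s in 𝓝[>] (0 : ℝ),
      ∀ ω, (∀ p : Nat.Primes, f p ω = 1 ∨ f p ω = -1) → 1 / 2 ≤ blockRatio f B s (l * s) ω := by
  have hlim : Tendsto (fun s : ℝ => ∏ p ∈ B, localRatio s (l * s) p 1) (𝓝 0) (𝓝 1) := by
    have h (p : Nat.Primes) :
        Tendsto (fun s : ℝ => localRatio s (l * s) p 1) (𝓝 0) (𝓝 1) := by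
      have hne : (1 : ℝ) - primeWeight p 0 ≠ 0 := (sub_pos.2 (primeWeight_lt_one p le_rfl)).ne'
      have h1 : Tendsto (fun s : ℝ => 1 - primeWeight p (l * s)) (𝓝 0)
          (𝓝 (1 - primeWeight p (l * 0))) :=
        (continuous_const.sub ((continuous_primeWeight p).comp
          (continuous_const.mul continuous_id))).tendsto 0
      have h2 : Tendsto (fun s : ℝ => 1 - primeWeight p s) (𝓝 0) (𝓝 (1 - primeWeight p 0)) :=
        (continuous_const.sub (continuous_primeWeight p)).tendsto 0
      have h3 := h1.div h2 hne
      rw [mul_zero, div_self hne] at h3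
      refine h3.congr fun s => ?_
      simp [localRatio]
    have := tendsto_finsetProd B fun p _ => h p
    rwa [Finset.prod_const_one] at this
  have hev := (hlim.mono_left (nhdsWithin_le_nhds (s := Set.Ioi 0))).eventually
    (lt_mem_nhds (show (1 / 2 : ℝ) < 1 by norm_num))
  filter_upwards [hev, self_mem_nhdsWithin] with s hs hs0 ω hω
  have hs0 : 0 < s := hs0
  have hls : 0 < l * s := mul_pos hl0 hs0
  refine hs.le.trans (Finset.prod_le_prod (fun p _ => ?_) fun p _ => ?_)
  · exact (IsRandomCompletelyMultiplicative.localRatio_pos hs0.le hls.le p (Or.inl rfl)).le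
  · exact localRatio_one_le hls.le (by nlinarith) p (hω p)

lemma eulerProd_mul_blockRatio {Ω : Type*} (f : ℕ → Ω → ℤ) {s t : ℝ} (ht : 0 ≤ t) {ω : Ω}
    (hω : ∀ p : Nat.Primes, f p ω = 1 ∨ f p ω = -1) (b : ℕ) :
    eulerProd f t b ω * blockRatio f (primesIco 0 b) s t ω = eulerProd f s b ω := by
  rw [eulerProd, eulerProd, blockRatio, ← Finset.prod_mul_distrib]
  refine Finset.prod_congr rfl fun p _ => ?_
  have h1 := primeWeight_lt_one p ht
  have h2 := primeWeight_pos p t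
  have hne : (1 : ℝ) - f p ω * primeWeight p t ≠ 0 := by
    rcases hω p with h | h <;> rw [h] <;> push_cast <;> linarith
  rw [localRatio, div_eq_mul_inv, ← mul_assoc, inv_mul_cancel₀ hne, one_mul]

/-- The Abel means at `s` and `l * s` over `n ≤ N` are well approximated by the Euler products
over primes below `b`, which are not too small. -/
def GoodApprox {Ω : Type*} (f : ℕ → Ω → ℤ) (l s : ℝ) (k b N : ℕ) (ω : Ω) : Prop :=
  (4 * k + 16) * s ≤ eulerProd f s b ω ∧ |abelSum f s N ω - eulerProd f s b ω| ≤ l * s ∧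
    |abelSum f (l * s) N ω - eulerProd f (l * s) b ω| ≤ l * s

/-- The Euler product at s is at least 8/l times that at ls. Of the factor 8, two is needed for the
conclusion; the rest, with the Euler product being at least 16 s, absorbs the errors of size ls. -/
lemma abelSum_gap {Ω : Type*} {f : ℕ → Ω → ℤ} {l s : ℝ} (hl0 : 0 < l) (hl1 : l < 1)
    (hs : 0 < s) {k a b N : ℕ} (hab : a ≤ b) {ω : Ω} (hω : ∀ p : Nat.Primes, f p ω = 1 ∨ f p ω = -1)
    (hgood : GoodApprox f l s k b N ω)
    (hlow : 1 / 2 ≤ blockRatio f (primesIco 0 a) s (l * s) ω)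
    (hblock : 16 / l ≤ blockRatio f (primesIco a b) s (l * s) ω) :
    (k : ℝ) ≤ abelSum f s N ω / s ∧
      2 * (abelSum f (l * s) N ω / (l * s)) ≤ abelSum f s N ω / s := by
  obtain ⟨h1, h2, h3⟩ := hgood
  have hls : 0 < l * s := mul_pos hl0 hs
  have hratio : 8 / l ≤ blockRatio f (primesIco 0 b) s (l * s) ω := by
    rw [blockRatio, prod_primesIco_zero hab]
    calc 8 / l = 1 / 2 * (16 / l) := by ring
      _ ≤ _ := mul_le_mul hlow hblock (by positivity) (by linarith)
  have hE := eulerProd_mul_blockRatio f (s := s) hls.le hω b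
  have hEpos : 0 ≤ eulerProd f (l * s) b ω := by
    refine Finset.prod_nonneg fun p _ => inv_nonneg.2 ?_
    have h1 := primeWeight_lt_one p hls.le
    have h2 := primeWeight_pos p (l * s)
    rcases hω p with h | h <;> rw [h] <;> push_cast <;> linarith
  have h4 : eulerProd f (l * s) b ω * 8 ≤ l * eulerProd f s b ω := by
    have := mul_le_mul_of_nonneg_left hratio hEpos
    rw [hE] at this
    have h5 := mul_le_mul_of_nonneg_left this hl0.le
    calc eulerProd f (l * s) b ω * 8 = l * (eulerProd f (l * s) b ω * (8 / l)) := by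
          field_simp
      _ ≤ _ := h5
  rw [abs_le] at h2 h3
  have hlss : l * s ≤ s := by nlinarith
  have hk : (0 : ℝ) ≤ k := Nat.cast_nonneg k
  have hks : 0 ≤ k * s := by positivity
  constructor
  · rw [le_div_iff₀ hs]
    nlinarith
  · rw [← mul_div_assoc, div_le_div_iff₀ hls hs]
    have h6 : 2 * abelSum f (l * s) N ω ≤ l * abelSum f s N ω := by
      have h7 : abelSum f (l * s) N ω ≤ l * eulerProd f s b ω / 8 + l * s := by linarith
      have h8 : l * (eulerProd f s b ω - s) ≤ l * abelSum f s N ω :=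
        mul_le_mul_of_nonneg_left (by linarith) hl0.le
      have h9 : l * (16 * s) ≤ l * eulerProd f s b ω :=
        mul_le_mul_of_nonneg_left (by nlinarith) hl0.le
      nlinarith
    calc 2 * abelSum f (l * s) N ω * s ≤ l * abelSum f s N ω * s :=
          mul_le_mul_of_nonneg_right h6 hs.le
      _ = _ := by ring

/-! ### Construction of the scales and Borel–Cantelli -/

namespace IsRandomCompletelyMultiplicative

variable {Ω : Type*} [MeasurableSpace Ω] {μ : Measure Ω} [IsProbabilityMeasure μ]
  {f : ℕ → Ω → ℤ}

/-- One scale of the construction. -/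
lemma exists_scale (hf : IsRandomCompletelyMultiplicative μ f) {l c : ℝ} (hl0 : 0 < l)
    (hl1 : l < 1) (hblock : ∀ a : ℕ, 196 ≤ a → ∀ᶠ s in 𝓝[>] (0 : ℝ),
      ∀ᶠ b in atTop, c ≤ μ.real {ω | 16 / l ≤ blockRatio f (primesIco a b) s (l * s) ω})
    (k : ℕ) (a : {a : ℕ // 196 ≤ a}) :
    ∃ (s : ℝ) (b : {a : ℕ // 196 ≤ a}) (N : ℕ), 0 < s ∧ a.1 ≤ b.1 ∧ k ≤ N ∧
      μ.real {ω | ¬ GoodApprox f l s k b N ω} ≤ (1 / 2) ^ k ∧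
      c ≤ μ.real {ω | 16 / l ≤ blockRatio f (primesIco a b) s (l * s) ω} ∧
      ∀ ω, (∀ p : Nat.Primes, f p ω = 1 ∨ f p ω = -1) →
        1 / 2 ≤ blockRatio f (primesIco 0 a) s (l * s) ω := by
  -- One third for each way to fail: a small Euler product, or a bad approximation at s or at ls.
  have hδ : (0 : ℝ) < (1 / 2) ^ k / 3 := by positivity
  have hsmall : ∀ᶠ s : ℝ in 𝓝[>] (0 : ℝ), (4 * (k : ℝ) + 16) * s < (1 / 2) ^ k / 3 := by
    have h : Tendsto (fun s : ℝ => (4 * k + 16) * s) (𝓝 0) (𝓝 ((4 * k + 16) * 0)) :=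
      (continuous_const.mul continuous_id).tendsto 0
    rw [mul_zero] at h
    exact (h.mono_left nhdsWithin_le_nhds).eventually (gt_mem_nhds hδ)
  -- The order of choice matters: s depends on the primes already used, then b on s, then N on b.
  obtain ⟨s, hs1, hs2, hs3, hs0⟩ := ((hblock a a.2).and (hsmall.and
    ((eventually_half_le_blockRatio f (primesIco 0 a) hl0 hl1).and self_mem_nhdsWithin))).exists
  have hs0 : 0 < s := hs0
  have hls : 0 < l * s := mul_pos hl0 hs0
  set ε := min (l * s) ((1 / 2) ^ k / 3) with hε
  have hε0 : 0 < ε := lt_min hls hδ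
  obtain ⟨b, hb1, hb2, hb3, hb4⟩ := (hs1.and
    ((hf.eventually_measureReal_abelSum_sub_eulerProd hs0 hε0).and
      ((hf.eventually_measureReal_abelSum_sub_eulerProd hls hε0).and
        (eventually_ge_atTop (a : ℕ))))).exists
  obtain ⟨N, hN1, hN2, hN3⟩ := (hb2.and (hb3.and (eventually_ge_atTop k))).exists
  refine ⟨s, ⟨b, a.2.trans hb4⟩, N, hs0, hb4, hN3, ?_, hb1, hs3⟩
  have hη : 0 < (4 * k + 16) * s := by positivity
  have hE := hf.measureReal_eulerProd_lt_le hs0.le b hη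
  have hsub : {ω | ¬ GoodApprox f l s k b N ω} ⊆
      ({ω | eulerProd f s b ω < (4 * k + 16) * s} ∪
        {ω | ε < |abelSum f s N ω - eulerProd f s b ω|}) ∪
        {ω | ε < |abelSum f (l * s) N ω - eulerProd f (l * s) b ω|} := by
    intro ω hω
    by_contra hcon
    simp only [Set.mem_union, Set.mem_ofPred_eq, not_or, not_lt] at hcon
    exact hω ⟨hcon.1.1, hcon.1.2.trans (min_le_left _ _), hcon.2.trans (min_le_left _ _)⟩
  have hle := (measureReal_mono (μ := μ) hsub).trans ((measureReal_union_le _ _).trans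
    (add_le_add (measureReal_union_le _ _) le_rfl))
  have hε1 : ε ≤ (1 / 2) ^ k / 3 := min_le_right _ _
  linarith

theorem ae_changesSignInfinitelyOften (hf : IsRandomCompletelyMultiplicative μ f) :
    ∀ᵐ ω ∂μ, ChangesSignInfinitelyOften (partialSum fun n => f n ω) := by
  obtain ⟨l, hl0, hl1, c, hc, hblock⟩ := hf.exists_block_probability
  choose s b N hs0 hab hN hbad hgood hlow using hf.exists_scale hl0 hl1 hblock
  -- Each block starts where the previous one ends, so the blocks are disjoint; the bound 196,
  -- carried along, keeps the moment estimates valid.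
  let a : ℕ → {a : ℕ // 196 ≤ a} := fun k => Nat.rec ⟨196, le_rfl⟩ (fun k x => b k x) k
  have hmono : Monotone fun k : ℕ => (a k).1 :=
    monotone_nat_of_le_succ (f := fun k : ℕ => (a k).1) fun k => hab k (a k)
  set σ : ℕ → ℝ := fun k => s k (a k) with hσ
  set A : ℕ → Set Ω := fun k =>
    {ω | 16 / l ≤ blockRatio f (primesIco (a k).1 (a (k + 1)).1) (σ k) (l * σ k) ω} with hA
  have hAm (k : ℕ) : MeasurableSet (A k) :=
    measurableSet_le measurable_const (hf.measurable_prod_primes _ _)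
  have hindep : iIndepSet A μ := by
    refine iIndepSet_of_disjoint_blocks (fun p => (hf.measurable_prime p).comap_le)
      hf.indep.iIndep (B := fun k => ↑(primesIco (a k).1 (a (k + 1)).1)) ?_ fun k => ?_
    · have key {j k : ℕ} (h : j < k) : Disjoint (primesIco (a j).1 (a (j + 1)).1 : Set Nat.Primes)
          (primesIco (a k).1 (a (k + 1)).1) := by
        rw [Set.disjoint_left]
        intro p hp hp'
        have h1 := (mem_primesIco.1 (Finset.mem_coe.1 hp)).2
        have h2 := (mem_primesIco.1 (Finset.mem_coe.1 hp')).1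
        have h3 : (a (j + 1)).1 ≤ (a k).1 := hmono h
        omega
      intro j k hjk
      rcases lt_or_gt_of_ne hjk with h | h
      · exact key h
      · exact (key h).symm
    · have hZ : Measurable[⨆ p ∈ (primesIco (a k).1 (a (k + 1)).1 : Set Nat.Primes),
          MeasurableSpace.comap (f p) inferInstance]
          (blockRatio f (primesIco (a k).1 (a (k + 1)).1) (σ k) (l * σ k)) := by
        refine Finset.measurable_fun_prod _ fun p hp => ?_
        have h1 : Measurable[MeasurableSpace.comap (f p) inferInstance]
            fun ω => localRatio (σ k) (l * σ k) p (f p ω) :=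
          (measurable_of_countable (localRatio (σ k) (l * σ k) p)).comp (comap_measurable (f p))
        exact h1.mono (le_iSup₂_of_le p (Finset.mem_coe.2 hp) le_rfl) le_rfl
      exact hZ measurableSet_Ici
  have hdiv : ∑' k, μ (A k) = ⊤ := by
    have hle (k : ℕ) : ENNReal.ofReal c ≤ μ (A k) := by
      rw [← ofReal_measureReal]
      exact ENNReal.ofReal_le_ofReal (hgood k (a k))
    refine top_unique ((ENNReal.tsum_const_eq_top_of_ne_zero (α := ℕ) ?_).symm.le.trans
      (ENNReal.tsum_le_tsum hle))
    exact (ENNReal.ofReal_pos.2 hc).ne'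
  have hlimsup : ∀ᵐ ω ∂μ, ∃ᶠ k in atTop, ω ∈ A k := by
    have h1 := measure_limsup_eq_one hAm hindep hdiv
    have h2 := (mem_ae_iff_prob_eq_one (MeasurableSet.measurableSet_limsup hAm)).2 h1
    filter_upwards [h2] with ω hω
    exact mem_limsup_iff_frequently_mem.1 hω
  have hbad_sum : ∑' k, μ {ω | ¬ GoodApprox f l (σ k) k (a (k + 1)).1 (N k (a k)) ω} ≠ ⊤ := by
    have h1 (k : ℕ) : μ {ω | ¬ GoodApprox f l (σ k) k (a (k + 1)).1 (N k (a k)) ω} ≤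
        ENNReal.ofReal ((1 / 2) ^ k) := by
      rw [← ofReal_measureReal]
      exact ENNReal.ofReal_le_ofReal (hbad k (a k))
    refine ne_top_of_le_ne_top ?_ (ENNReal.tsum_le_tsum h1)
    rw [← ENNReal.ofReal_tsum_of_nonneg (fun k => by positivity) summable_geometric_two]
    exact ENNReal.ofReal_ne_top
  have hev : ∀ᵐ ω ∂μ, ∀ᶠ k in atTop,
      GoodApprox f l (σ k) k (a (k + 1)).1 (N k (a k)) ω := by
    filter_upwards [ae_eventually_notMem hbad_sum] with ω hω
    filter_upwards [hω] with k hk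
    exact not_not.1 hk
  filter_upwards [hlimsup, hev, hf.ae_eq_one_or] with ω h1 h2 hω
  refine changesSignInfinitelyOften_of_frequently _ σ (fun k => l * σ k) (fun k => N k (a k))
    (fun k => mul_pos hl0 (hs0 k _)) (fun k => ?_) (fun k => hN k _) ?_
  · have := hs0 k (a k)
    simp only [hσ]
    nlinarith
  · refine (h1.and_eventually h2).mono fun k hk => ?_
    have := abelSum_gap hl0 hl1 (hs0 k (a k)) (hab k (a k)) hω hk.2 (hlow k (a k) ω hω) hk.1
    rw [abelSum_div_eq, abelSum_div_eq] at this
    exact this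

end IsRandomCompletelyMultiplicative

theorem theorem1 {Ω : Type*} [MeasurableSpace Ω] (μ : Measure Ω) [IsProbabilityMeasure μ]
    (f : ℕ → Ω → ℤ) (hf : IsRandomCompletelyMultiplicative μ f) :
    ∀ᵐ ω ∂μ, ChangesSignInfinitelyOften (partialSum fun n => f n ω) :=
  hf.ae_changesSignInfinitelyOften
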